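/- For $n\ge 1$ let $\mathfrak S_n$ be the symmetric group on $\{1,\dots,n\}$. For $\sigma\in\mathfrak S_n$ let $\mathrm{Des}(\sigma)=\{i : 1\le i\le n-1,\ \sigma(i)>\sigma(i+1)\}$, and put $$\mathrm{des}(\sigma)=|\mathrm{Des}(\sigma)|,\quad \mathrm{maj}(\sigma)=\sum_{i\in\mathrm{Des}(\sigma)} i,\quad \mathrm{exc}(\sigma)=|\{i:\sigma(i)>i\}|,\quad \mathrm{fix}(\sigma)=|\{i:\sigma(i)=i\}|.$$ Let $$A_n^{\mathrm{maj},\mathrm{des},\mathrm{exc},\mathrm{fix}}(q,p,t,r)=\sum_{\sigma\in\mathfrak S_n}q^{\mathrm{maj}(\sigma)}p^{\mathrm{des}(\sigma)}t^{\mathrm{exc}(\sigma)}r^{\mathrm{fix}(\sigma)}\quad(n\ge1),\qquad A_0^{\mathrm{maj},\mathrm{des},\mathrm{exc},\mathrm{fix}}(q,p,t,r)=1,$$ and let $(a;q)_0=1$ and $(a;q)_n=(1-a)(1-aq)\cdots(1-aq^{n-1})$ for $n\ge1$. Then, in the ring of formal power series $\mathbb Q[[q,p,t,r,z]]$, $$\sum_{n\ge0}A_n^{\mathrm{maj},\mathrm{des},\mathrm{exc},\mathrm{fix}}(q,p,t,r)\frac{z^n}{(p;q)_{n+1}}=\sum_{m\ge0}p^m\frac{(1-qt)\,(z;q)_m\,(ztq;q)_m}{\bigl((z;q)_m-tq\,(ztq;q)_m\bigr)\,(zr;q)_{m+1}}.$$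 Here all denominators have constant coefficient $1$, and both sums converge coefficientwise (each coefficient of the sum receives finitely many nonzero contributions). -/

import Mathlib

open scoped MvPowerSeries.WithPiTopology

namespace PermStat

/-- The descent set, as a set of indices `i : Fin n`. The letter with index `i` stands at
position `i + 1` of the one-line notation. -/
def Des {n : ℕ} (σ : Equiv.Perm (Fin n)) : Finset (Fin n) :=
  {i | ∃ h : (i : ℕ) + 1 < n, σ ⟨(i : ℕ) + 1, h⟩ < σ i}

/-- The descent number. -/
def des {n : ℕ} (σ : Equiv.Perm (Fin n)) : ℕ := (Des σ).card

/-- The major index: the sum of the (one-based) descent positions. -/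
def maj {n : ℕ} (σ : Equiv.Perm (Fin n)) : ℕ := ∑ i ∈ Des σ, ((i : ℕ) + 1)

/-- The excedance number. (The last index is never an excedance position.) -/
def exc {n : ℕ} (σ : Equiv.Perm (Fin n)) : ℕ := ({i | i < σ i} : Finset (Fin n)).card

/-- The number of fixed points. -/
def fix {n : ℕ} (σ : Equiv.Perm (Fin n)) : ℕ := ({i | σ i = i} : Finset (Fin n)).card

/-- The enumerator of `S_n` by `(maj, des, exc, fix)`, evaluated at `(q, p, t, r)`.
It is `1` for `n = 0`. -/
def enumerator {R : Type*} [CommRing R] (n : ℕ) (q p t r : R) : R :=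
  ∑ σ : Equiv.Perm (Fin n), q ^ maj σ * p ^ des σ * t ^ exc σ * r ^ fix σ

end PermStat

/-- The `q`-shifted factorial `(a;q)_n = (1 - a)(1 - aq) ⋯ (1 - aq^(n-1))`. -/
def qPoch {R : Type*} [CommRing R] (a q : R) (n : ℕ) : R :=
  ∏ i ∈ Finset.range n, (1 - a * q ^ i)

namespace FiveVar

/-- The ring `ℚ[[q, p, t, r, z]]`. Its `⁻¹` is the inverse of a series
with nonzero constant coefficient. -/
abbrev Series : Type := MvPowerSeries (Fin 5) ℚ

/-- The variable `q`. -/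
noncomputable def q : Series := MvPowerSeries.X 0
/-- The variable `p`. -/
noncomputable def p : Series := MvPowerSeries.X 1
/-- The variable `t`. -/
noncomputable def t : Series := MvPowerSeries.X 2
/-- The variable `r`. -/
noncomputable def r : Series := MvPowerSeries.X 3
/-- The variable `z`. -/
noncomputable def z : Series := MvPowerSeries.X 4

/-- `f 0 + f 1 + f 2 + ⋯ = S` as formal power series: the sum converges to `S` for the
coefficientwise topology, the coefficient field being discrete. -/
def FormalHasSum (f : ℕ → Series) (S : Series) : Prop :=
  letI : TopologicalSpace ℚ := ⊥
  HasSum f S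

/-- The series inverted on the left-hand side have constant coefficient `1`. -/
theorem constantCoeff_lhs_denominator (n : ℕ) :
    MvPowerSeries.constantCoeff (qPoch p q (n + 1)) = 1 := by
  simp [qPoch, map_prod, p, q]

/-- The series inverted on the right-hand side have constant coefficient `1`. -/
theorem constantCoeff_rhs_denominator (m : ℕ) :
    MvPowerSeries.constantCoeff
      ((qPoch z q m - t * q * qPoch (z * t * q) q m) * qPoch (z * r) q (m + 1)) = 1 := by
  simp [qPoch, map_prod, z, q, t, r]

end FiveVar

/-! Both sides are the sum of one family, `wordTerm`, over all triples (m, n, w) with w a word of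
length n in the letters 0, …, m. With σ the permutation that stably sorts w, its term is p^m t^{exc
σ} r^{fix σ} ∏_j z q^{m - w_j}. It lies in I^(m+n), where I is the ideal of series without constant
term, so the family is summable and may be grouped by n or by m.

Fixed n: a pair (m, w) amounts to σ together with the sorted sequence of letters bounded by m, which
must increase strictly at each descent of σ. The forced steps contribute q^maj p^des. The n + 1 free
gaps contribute geometric series in p q^j, 0 ≤ j ≤ n, hence 1/(p;q)_{n+1} (`hasSum_wordTerm`).

Fixed m: put y_a = z q^{m-a} and cut w into blocks, the block of a being the positions that the
letters a occupy after sorting. A letter b in the block of a ≠ b is an excedance if b < a, and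
neither an excedance nor a fixed point if b > a. A letter a in its own block has sorted position
minus position equal to the number of a in earlier blocks minus the number of other letters already
read in this block. So its factor does not depend on the preceding letters a of the block, and runs
of a sum to geometric series (`hasSum_blockWeight_fibre`). The remaining sum, over blocks free of
their own letter, is a MacMahon master sum with entries y_b/(1-y_b) above and t y_b/(1-t y_b) below
the diagonal. It is evaluated by eliminating variables (`hasSum_masterTerm_eliminationMatrix`), and
for geometric y the answer telescopes (`mixedSum_geometric`). -/

open Filter Topology

/-! ### Geometric series in complete nonarchimedean rings. -/

namespace AdicSum

theorem hasSum_of_eq {M ι : Type*} [AddCommMonoid M] [TopologicalSpace M] {f g : ι → M} {a b : M}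
    (h : HasSum f a) (hf : ∀ i, g i = f i) (hab : b = a) : HasSum g b := by
  rwa [funext hf, hab]

variable {R : Type*} [CommRing R] [UniformSpace R]

/-- The powers of the ideal `I` converge to zero. -/
def PowersTendToZero (I : Ideal R) : Prop :=
  ∀ U ∈ 𝓝 (0 : R), ∃ n : ℕ, ((I ^ n : Ideal R) : Set R) ⊆ U

variable [IsUniformAddGroup R] [NonarchimedeanRing R]

theorem hasSum_pi_prod {N : ℕ} {ι : Fin N → Type*} {f : ∀ a, ι a → R} {s : Fin N → R}
    (h : ∀ a, HasSum (f a) (s a)) :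
    HasSum (fun e : ∀ a, ι a => ∏ a, f a (e a)) (∏ a, s a) := by
  induction N with
  | zero => simpa only [Finset.univ_eq_empty, Finset.prod_empty, Finset.univ_unique, Finset.sum_const,
      Finset.card_singleton, one_smul] using hasSum_fintype (fun _ : (∀ a : Fin 0, ι a) => (1 : R))
  | succ N ih =>
    rw [Fin.prod_univ_succ]
    have := (h 0).mul_of_nonarchimedean (ih fun a => h a.succ)
    rw [← (Fin.consEquiv ι).hasSum_iff]
    simpa [Function.comp_def, Fin.prod_univ_succ] using this

variable [CompleteSpace R]

theorem summable_of_mem_pow {I : Ideal R} (hI : PowersTendToZero I) {ι : Type*} {f : ι → R}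
    (deg : ι → ℕ) (hfin : ∀ n, {i | deg i < n}.Finite) (hf : ∀ i, f i ∈ I ^ deg i) :
    Summable f := by
  apply NonarchimedeanAddGroup.summable_of_tendsto_cofinite_zero
  intro U hU
  obtain ⟨n, hn⟩ := hI U hU
  refine Filter.mem_cofinite.2 ((hfin n).subset fun i hi => ?_)
  by_contra h
  exact hi (hn (Ideal.pow_le_pow_right (not_lt.1 h) (hf i)))

variable [T2Space R]

theorem exists_mul_one_sub_eq_one {I : Ideal R} (hI : PowersTendToZero I) {y : R} (hy : y ∈ I) :
    ∃ g : R, g * (1 - y) = 1 := by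
  have hs : Summable (fun k : ℕ => y ^ k) :=
    summable_of_mem_pow hI id (fun n => Set.finite_lt_nat n) fun k => Ideal.pow_mem_pow hy k
  have h := hs.hasSum
  have h3 : ∑' k, y ^ k - ∑ i ∈ Finset.range 1, y ^ i = y * ∑' k, y ^ k :=
    ((hasSum_nat_add_iff' 1).2 h).unique (by simpa [pow_succ'] using h.mul_left y)
  refine ⟨∑' k, y ^ k, ?_⟩
  simp at h3
  linear_combination h3

theorem hasSum_geometric {I : Ideal R} (hI : PowersTendToZero I) {y g : R} (hy : y ∈ I)
    (hg : g * (1 - y) = 1) : HasSum (fun k : ℕ => y ^ k) g := by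
  have hs : Summable (fun k : ℕ => y ^ k) :=
    summable_of_mem_pow hI id (fun n => Set.finite_lt_nat n) fun k => Ideal.pow_mem_pow hy k
  have h := hs.hasSum
  have h3 : ∑' k, y ^ k - ∑ i ∈ Finset.range 1, y ^ i = y * ∑' k, y ^ k :=
    ((hasSum_nat_add_iff' 1).2 h).unique (by simpa [pow_succ'] using h.mul_left y)
  simp at h3
  rwa [show ∑' k, y ^ k = g by linear_combination g * h3 - (∑' k, y ^ k) * hg] at h

-- Induction on d by Cauchy products, with the hockey-stick identity.
omit [CompleteSpace R] in
theorem hasSum_choose_geometric {y g : R} (h : HasSum (fun k : ℕ => y ^ k) g) (d : ℕ) :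
    HasSum (fun k : ℕ => ((k + d).choose d : R) * y ^ k) (g ^ (d + 1)) := by
  induction d with
  | zero => simpa using h
  | succ d ih =>
    have h1 := ih.mul_of_nonarchimedean h
    set F : ℕ → R := fun k => ((k + d).choose d : R) * y ^ k with hF
    set G : ℕ → R := fun k => y ^ k with hG
    have h2 := summable_sum_mul_antidiagonal_of_summable_mul (f := F) (g := G) h1.summable
    have h3 := Summable.tsum_mul_tsum_eq_tsum_sum_antidiagonal (f := F) (g := G) ih.summable
      h.summable h1.summable
    rw [ih.tsum_eq, h.tsum_eq] at h3
    rw [pow_succ g (d + 1), h3]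
    have key : (fun n : ℕ => ∑ kl ∈ Finset.HasAntidiagonal.antidiagonal n, F kl.1 * G kl.2)
        = fun k : ℕ => ((k + (d + 1)).choose (d + 1) : R) * y ^ k := by
      funext n
      rw [show ∑ kl ∈ Finset.HasAntidiagonal.antidiagonal n, F kl.1 * G kl.2
          = ∑ kl ∈ Finset.HasAntidiagonal.antidiagonal n, ((kl.1 + d).choose d : R) * y ^ n from
        Finset.sum_congr rfl fun kl hkl => by
          rw [hF, hG, mul_assoc, ← pow_add, Finset.HasAntidiagonal.mem_antidiagonal.1 hkl], ← Finset.sum_mul,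
        Finset.Nat.sum_antidiagonal_eq_sum_range_succ_mk, ← Nat.cast_sum]
      rw [Nat.succ_eq_add_one, Nat.sum_range_add_choose, add_assoc]
    rw [← key]
    exact h2.hasSum

end AdicSum

/-! ### The MacMahon master sum by elimination of variables. -/

namespace AdicSum

section MacMahonMaster

variable {R : Type*} [CommRing R]

/-- The coefficient of `X^c` in `∏ a, (∑ b, A a b * X b) ^ c a`. -/
noncomputable def masterTerm {N : ℕ} (A : Fin N → Fin N → R) (c : Fin N → ℕ) : R :=
  MvPolynomial.coeff (Finsupp.equivFunOnFinite.symm c)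
    (∏ a, (∑ b, MvPolynomial.C (A a b) * MvPolynomial.X b) ^ c a)

theorem coeff_linear_pow {S : Type*} [CommRing S] (L b : S) (k m : ℕ) :
    ((Polynomial.C L + Polynomial.C b * Polynomial.X) ^ k).coeff m
      = b ^ m * L ^ (k - m) * (k.choose m : S) := by
  rw [add_comm, add_pow, Polynomial.finsetSum_coeff]
  have : ∀ i, ((Polynomial.C b * Polynomial.X) ^ i * Polynomial.C L ^ (k - i)
      * (k.choose i : Polynomial S)).coeff m
      = if m = i then b ^ m * L ^ (k - m) * (k.choose m : S) else 0 := by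
    intro i
    rw [mul_pow, ← Polynomial.C_pow, ← Polynomial.C_pow, ← Polynomial.C_eq_natCast,
      Polynomial.coeff_mul_C, Polynomial.coeff_mul_C, Polynomial.coeff_C_mul_X_pow]
    split_ifs with h
    · subst h; rfl
    · simp
  simp_rw [this]
  rw [Finset.sum_ite_eq]
  split_ifs with h
  · rfl
  · rw [Nat.choose_eq_zero_of_lt (by simpa using h)]; simp

theorem masterTerm_mem_pow {N : ℕ} {I : Ideal R} {A : Fin N → Fin N → R}
    (hA : ∀ a b, A a b ∈ I) (c : Fin N → ℕ) : masterTerm A c ∈ I ^ (∑ a, c a) := by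
  have h : (∏ a, (∑ b, MvPolynomial.C (A a b) * MvPolynomial.X b : MvPolynomial (Fin N) R) ^ c a)
      ∈ (I.map MvPolynomial.C) ^ (∑ a, c a) := by
    rw [← Finset.prod_pow_eq_pow_sum]
    refine Ideal.prod_mem_prod fun a _ => Ideal.pow_mem_pow (Ideal.sum_mem _ fun b _ => ?_) _
    exact Ideal.mul_mem_right _ _ (Ideal.mem_map_of_mem _ (hA a b))
  rw [← Ideal.map_pow] at h
  exact MvPolynomial.mem_map_C_iff.1 h _

theorem masterTerm_cons {N : ℕ} (A : Fin (N + 1) → Fin (N + 1) → R) (k : ℕ) (c : Fin N → ℕ) :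
    masterTerm A (Fin.cons k c : Fin (N + 1) → ℕ)
      = MvPolynomial.coeff (Finsupp.equivFunOnFinite.symm c)
        (((∏ a : Fin N, (Polynomial.C (∑ b : Fin N,
              MvPolynomial.C (A a.succ b.succ) * MvPolynomial.X b)
            + Polynomial.C (MvPolynomial.C (A a.succ 0)) * Polynomial.X) ^ c a)
          * (Polynomial.C (∑ b : Fin N, MvPolynomial.C (A 0 b.succ) * MvPolynomial.X b)
            + Polynomial.C (MvPolynomial.C (A 0 0)) * Polynomial.X) ^ k).coeff k) := by
  have h : Finsupp.equivFunOnFinite.symm (Fin.cons k c : Fin (N + 1) → ℕ)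
      = Finsupp.cons k (Finsupp.equivFunOnFinite.symm c) := by
    ext a
    refine Fin.cases ?_ (fun a => ?_) a <;> simp
  rw [masterTerm, h, ← MvPolynomial.finSuccEquiv_coeff_coeff]
  congr 2
  rw [map_prod, Fin.prod_univ_succ, mul_comm]
  simp only [map_pow, map_sum, map_mul, map_add, Fin.sum_univ_succ, Fin.cons_zero, Fin.cons_succ,
    MvPolynomial.finSuccEquiv_apply, MvPolynomial.eval₂Hom_C, MvPolynomial.eval₂Hom_X',
    Fin.cases_zero, Fin.cases_succ, RingHom.comp_apply, add_comm]

theorem finite_sum_lt {N : ℕ} (n : ℕ) : {c : Fin N → ℕ | ∑ a, c a < n}.Finite := by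
  refine (Set.Finite.pi (t := fun _ : Fin N => Set.Iio n) fun _ => Set.finite_Iio n).subset ?_
  intro c hc a _
  exact lt_of_le_of_lt (Finset.single_le_sum (f := c) (fun _ _ => Nat.zero_le _)
    (Finset.mem_univ a)) hc

variable [UniformSpace R] [IsUniformAddGroup R] [NonarchimedeanRing R]
  [CompleteSpace R] [T2Space R]

-- By linearity G = s X^i. The coefficients are then s L^i C(i+j, i) a^j with k = i + j, and they
-- sum to s L^i g^(i+1). The functional φ is needed because S carries no topology.
omit [CompleteSpace R] in
theorem hasSum_coeff_mul_linear_pow {S : Type*} [CommRing S] [Algebra R S] (φ : S →ₗ[R] R)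
    (G : Polynomial S) (L : S) {a g : R} (h : HasSum (fun k : ℕ => a ^ k) g) :
    HasSum (fun k => φ ((G * (Polynomial.C L
        + Polynomial.C (algebraMap R S a) * Polynomial.X) ^ k).coeff k))
      (g * φ (G.eval (algebraMap R S g * L))) := by
  induction G using Polynomial.induction_on' with
  | add p q hp hq =>
    simpa only [add_mul, Polynomial.coeff_add, map_add, Polynomial.eval_add, mul_add]
      using hp.add hq
  | monomial i s =>
    have hinj : Function.Injective (fun j : ℕ => j + i) := add_left_injective i
    have hz : ∀ k ∉ Set.range (fun j : ℕ => j + i),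
        φ ((Polynomial.monomial i s * (Polynomial.C L
          + Polynomial.C (algebraMap R S a) * Polynomial.X) ^ k).coeff k) = 0 := by
      intro k hk
      have hki : k < i := by
        by_contra hcon
        exact hk ⟨k - i, by simp; omega⟩
      rw [← Polynomial.C_mul_X_pow_eq_monomial, mul_assoc, Polynomial.coeff_C_mul,
        Polynomial.coeff_X_pow_mul', if_neg (by omega), mul_zero, map_zero]
    rw [← hinj.hasSum_iff hz]
    have h2 := (hasSum_choose_geometric h i).mul_left (φ (s * L ^ i))
    refine hasSum_of_eq h2 (fun j => ?_) ?_
    · simp only [Function.comp_apply]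
      rw [← Polynomial.C_mul_X_pow_eq_monomial, mul_assoc, Polynomial.coeff_C_mul,
        Polynomial.coeff_X_pow_mul', if_pos (by omega), Nat.add_sub_cancel, coeff_linear_pow,
        Nat.add_sub_cancel_left, Nat.choose_symm_add, ← map_pow]
      rw [show s * (algebraMap R S (a ^ j) * L ^ i * ((j + i).choose i : S))
        = (a ^ j * ((j + i).choose i : R)) • (s * L ^ i) by
          rw [Algebra.smul_def, map_mul, map_natCast]; ring, map_smul, smul_eq_mul]
      ring
    · rw [Polynomial.eval_monomial, mul_pow, ← map_pow,
        show s * (algebraMap R S (g ^ i) * L ^ i) = g ^ i • (s * L ^ i) by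
          rw [Algebra.smul_def]; ring, map_smul, smul_eq_mul]
      ring

/-- Summing over the exponent of X_0 substitutes g ∑_b A_{0b} X_b for X_0 in the other rows, that
is, it solves row 0 for X_0. The other rows become those of the Schur complement. -/
theorem hasSum_masterTerm_succ {N : ℕ} {I : Ideal R} (hI : PowersTendToZero I)
    {A : Fin (N + 1) → Fin (N + 1) → R} (hA : ∀ a b, A a b ∈ I) {g F : R}
    (hg : g * (1 - A 0 0) = 1)
    (h : HasSum (masterTerm fun a b : Fin N => A a.succ b.succ + A a.succ 0 * g * A 0 b.succ) F) :
    HasSum (masterTerm A) (g * F) := by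
  have hs : Summable (masterTerm A) :=
    summable_of_mem_pow hI (fun c => ∑ a, c a) (fun n => finite_sum_lt n) (masterTerm_mem_pow hA)
  let e : (Fin N → ℕ) × ℕ ≃ (Fin (N + 1) → ℕ) :=
    (Equiv.prodComm _ _).trans (Fin.consEquiv fun _ => ℕ)
  have h1 : HasSum (fun x : (Fin N → ℕ) × ℕ => masterTerm A (Fin.cons x.2 x.1 : Fin (N + 1) → ℕ))
      (∑' c, masterTerm A c) := (e.hasSum_iff (f := masterTerm A)).2 hs.hasSum
  have h2 := h1.prod_fiberwise (g := fun c => g * masterTerm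
      (fun a b : Fin N => A a.succ b.succ + A a.succ 0 * g * A 0 b.succ) c) (fun c => by
    simp only [masterTerm_cons]
    have := hasSum_coeff_mul_linear_pow (S := MvPolynomial (Fin N) R)
      (MvPolynomial.lcoeff R (Finsupp.equivFunOnFinite.symm c))
      (∏ a : Fin N, (Polynomial.C (∑ b : Fin N,
              MvPolynomial.C (A a.succ b.succ) * MvPolynomial.X b)
            + Polynomial.C (MvPolynomial.C (A a.succ 0)) * Polynomial.X) ^ c a)
      (∑ b : Fin N, MvPolynomial.C (A 0 b.succ) * MvPolynomial.X b)
      (hasSum_geometric hI (hA 0 0) hg)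
    refine hasSum_of_eq this (fun _ => rfl) ?_
    unfold masterTerm
    rw [Polynomial.eval_prod, MvPolynomial.lcoeff_apply]
    congr 2
    refine Finset.prod_congr rfl fun a _ => ?_
    simp only [Polynomial.eval_pow, Polynomial.eval_add, Polynomial.eval_mul, Polynomial.eval_C,
      Polynomial.eval_X, MvPolynomial.algebraMap_eq, Finset.mul_sum, ← Finset.sum_add_distrib,
      map_add, map_mul]
    congr 1
    refine Finset.sum_congr rfl fun b _ => by ring)
  rw [← h2.unique (h.mul_left g)]
  exact hs.hasSum

/-- The sum `∑ b, u b * (∏ a < b, (1 + v a)) * ∏ a > b, (1 + u a)`. -/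
def mixedSum : {N : ℕ} → (Fin N → R) → (Fin N → R) → R
  | 0, _, _ => 0
  | _ + 1, u, v => u 0 * ∏ a : Fin _, (1 + u a.succ) + (1 + v 0) * mixedSum (Fin.tail u) (Fin.tail v)

/-- The matrix with entries `v b` below the diagonal, `u b` above the diagonal and `0` on it,
after the eliminations recorded by the parameter `s`. -/
def eliminationMatrix {N : ℕ} (s : R) (u v : Fin N → R) (a b : Fin N) : R :=
  if a < b then (1 + s) * u b else if b < a then v b + s * u b else s * u b

/-- The one-parameter family of matrices is stable under elimination of the first variable, so an
induction with s free evaluates the sum; only s = 0 is wanted in the end. -/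
theorem hasSum_masterTerm_eliminationMatrix {N : ℕ} {I : Ideal R} (hI : PowersTendToZero I)
    (s : R) {u v : Fin N → R} (hu : ∀ a, u a ∈ I) (hv : ∀ a, v a ∈ I) {F : R}
    (hF : F * (∏ a, (1 + u a) - (1 + s) * mixedSum u v) = 1) :
    HasSum (masterTerm (eliminationMatrix s u v)) F := by
  induction N generalizing s F with
  | zero =>
    have : F = 1 := by simpa [mixedSum] using hF
    subst this
    have h := hasSum_unique (masterTerm (eliminationMatrix s u v))
    refine hasSum_of_eq h (fun _ => rfl) ?_
    rw [masterTerm, Finset.univ_eq_empty, Finset.prod_empty, MvPolynomial.coeff_one,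
      if_pos (Subsingleton.elim _ _)]
  | succ N ih =>
    obtain ⟨g, hg⟩ := exists_mul_one_sub_eq_one hI (I.mul_mem_left s (hu 0))
    -- The Schur complement has entries (1 + s)(1 + v 0) g u_b above the diagonal, which must be (1
    -- + s') u_b. The pivot 1 - s u_0 is split off from the reciprocal of F.
    have h := ih ((1 + s) * (1 + v 0) * g - 1) (u := Fin.tail u) (v := Fin.tail v)
      (fun a => hu a.succ) (fun a => hv a.succ) (F := (1 - s * u 0) * F) (by
        rw [Fin.prod_univ_succ] at hF
        simp only [mixedSum] at hF
        rw [show ∏ a, (1 + Fin.tail u a) = ∏ a : Fin N, (1 + u a.succ) from rfl]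
        linear_combination hF - F * (1 + s) * (1 + v 0)
          * mixedSum (Fin.tail u) (Fin.tail v) * hg)
    have h0 : eliminationMatrix s u v 0 0 = s * u 0 := by simp [eliminationMatrix]
    have hmem : ∀ a b, eliminationMatrix s u v a b ∈ I := by
      intro a b
      unfold eliminationMatrix
      split_ifs
      · exact I.mul_mem_left _ (hu b)
      · exact I.add_mem (hv b) (I.mul_mem_left _ (hu b))
      · exact I.mul_mem_left _ (hu b)
    refine hasSum_of_eq (hasSum_masterTerm_succ hI hmem (g := g) (F := (1 - s * u 0) * F)
      (by rw [h0, hg]) ?_) (fun _ => rfl) (by linear_combination - F * hg)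
    convert h using 2
    funext a b
    simp only [eliminationMatrix, Fin.succ_lt_succ_iff, Fin.succ_pos, Fin.not_lt_zero, if_true,
      if_false, Fin.tail]
    split_ifs
    · linear_combination (-(1 + s) * u b.succ) * hg
    · linear_combination (-(1 + s) * u b.succ) * hg
    · linear_combination (-(1 + s) * u b.succ) * hg

end MacMahonMaster
end AdicSum

/-! ### Summation over the letters a in the block of a. -/

namespace BlockSum

open AdicSum

section Defs

variable {R : Type*} [CommRing R]

/-- The factor of a letter whose sorted position exceeds its position by `k`. -/
def phase (t r : R) (k : ℤ) : R := if 0 < k then 1 else if k = 0 then r else t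

/-- The factor of the letter `b` in the block of a different letter `a`. -/
def offWeight {N : ℕ} (t : R) (y : Fin N → R) (a b : Fin N) : R := (if b < a then t else 1) * y b

/-- The weight of a word in the block of `a`, when `k` more letters `a` than other letters
of this block have been read so far. -/
def blockWeight {N : ℕ} (t r : R) (y : Fin N → R) (a : Fin N) : ℤ → List (Fin N) → R
  | _, [] => 1
  | k, b :: l => if b = a then phase t r k * y a * blockWeight t r y a k l
      else offWeight t y a b * blockWeight t r y a (k - 1) l

theorem blockWeight_replicate_append {N : ℕ} (t r : R) (y : Fin N → R) (a : Fin N) (k : ℤ)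
    (n : ℕ) (l : List (Fin N)) :
    blockWeight t r y a k (List.replicate n a ++ l)
      = (phase t r k * y a) ^ n * blockWeight t r y a k l := by
  induction n with
  | zero => simp
  | succ n ih =>
    rw [List.replicate_succ, List.cons_append, blockWeight, if_pos rfl, ih, pow_succ']
    ring

/-- The arguments run through k, k - 1, …, -l: k positive ones, zero, and l negative ones. -/
theorem prod_eq_of_sign (G : ℤ → R) {g₁ g₀ g₂ : R} (k l : ℕ) (h₁ : ∀ i, 0 < i → G i = g₁)
    (h₀ : G 0 = g₀) (h₂ : ∀ i, i < 0 → G i = g₂) :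
    ∏ i ∈ Finset.range (k + l + 1), G (k - i) = g₁ ^ k * g₀ * g₂ ^ l := by
  induction k with
  | zero =>
    induction l with
    | zero => simp [h₀]
    | succ l ih =>
      rw [← add_assoc, Finset.prod_range_succ, ih, h₂ _ (by push_cast; omega), pow_succ]
      ring
  | succ k ih =>
    rw [show k + 1 + l + 1 = (k + l + 1) + 1 by ring, Finset.prod_range_succ',
      h₁ _ (by push_cast; omega)]
    rw [show ∏ i ∈ Finset.range (k + l + 1), G (((k + 1 : ℕ) : ℤ) - ((i + 1 : ℕ) : ℤ))
      = ∏ i ∈ Finset.range (k + l + 1), G (k - i) from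
      Finset.prod_congr rfl fun i _ => by congr 1; push_cast; ring, ih, pow_succ]
    ring

/-- The words with a given word of letters other than `a`. -/
abbrev Fibre {N : ℕ} (a : Fin N) (l' : List (Fin N)) : Type :=
  {l : List (Fin N) // l.filter (fun b => b ≠ a) = l'}

/-- A word without other letters than `a` is a run of `a`. -/
def fibreNil {N : ℕ} (a : Fin N) (n : ℕ) : Fibre a [] :=
  ⟨List.replicate n a, by simp⟩

theorem fibreNil_bijective {N : ℕ} (a : Fin N) : Function.Bijective (fibreNil a) := by
  refine ⟨fun n n' h => ?_, fun ⟨l, hl⟩ => ⟨l.length, ?_⟩⟩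
  · simpa [fibreNil] using congrArg (fun x => x.1.length) h
  · refine Subtype.ext (List.eq_replicate_iff.2 ⟨rfl, fun b hb => ?_⟩).symm
    simpa using List.filter_eq_nil_iff.1 hl b hb

/-- A word with a letter `b ≠ a` is a run of `a`, the first such letter, and a shorter word. -/
def fibreCons {N : ℕ} {a b : Fin N} (hb : b ≠ a) (l' : List (Fin N)) (x : ℕ × Fibre a l') :
    Fibre a (b :: l') :=
  ⟨List.replicate x.1 a ++ b :: x.2.1, by
    rw [List.filter_append, List.filter_cons_of_pos (by simpa using hb), x.2.2]; simp⟩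

theorem replicate_append_cons_inj {α : Type*} {a b : α} (hb : b ≠ a) {l m : List α} :
    ∀ n n', List.replicate n a ++ b :: l = List.replicate n' a ++ b :: m → n = n' ∧ l = m
  | 0, 0, h => by simpa using h
  | 0, n' + 1, h => by simp [List.replicate_succ, hb] at h
  | n + 1, 0, h => by simp [List.replicate_succ, hb.symm] at h
  | n + 1, n' + 1, h => by
    have := replicate_append_cons_inj hb n n' (by simpa [List.replicate_succ] using h)
    simpa using this

theorem fibreCons_bijective {N : ℕ} {a b : Fin N} (hb : b ≠ a) (l' : List (Fin N)) :
    Function.Bijective (fibreCons hb l') := by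
  constructor
  · rintro ⟨n, l, hl⟩ ⟨n', m, hm⟩ h
    have h1 : List.replicate n a ++ b :: l = List.replicate n' a ++ b :: m :=
      congrArg Subtype.val h
    obtain ⟨rfl, rfl⟩ := replicate_append_cons_inj hb n n' h1
    rfl
  · rintro ⟨l, hl⟩
    obtain ⟨l₁, l₂, rfl, h1, -, h2⟩ := List.filter_eq_cons_iff.1 hl
    refine ⟨(l₁.length, ⟨l₂, h2⟩), Subtype.ext ?_⟩
    change List.replicate l₁.length a ++ b :: l₂ = l₁ ++ b :: l₂
    rw [← List.eq_replicate_iff.2 ⟨rfl, fun c hc => by simpa using h1 c hc⟩]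

end Defs

section Sums

variable {R : Type*} [CommRing R] [UniformSpace R] [IsUniformAddGroup R] [NonarchimedeanRing R]

/-- The other letters separate `l'.length + 1` runs of a. The phase is constant on a run and its
argument drops by one at each other letter, so the runs sum independently to G k, G (k - 1), …. -/
theorem hasSum_blockWeight_fibre {N : ℕ} {t r : R} {y : Fin N → R} {a : Fin N} {G : ℤ → R}
    (hG : ∀ k, HasSum (fun n : ℕ => (phase t r k * y a) ^ n) (G k)) {l' : List (Fin N)}
    (hl' : a ∉ l') (k : ℤ) :
    HasSum (fun l : Fibre a l' => blockWeight t r y a k l.1)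
      ((l'.map (offWeight t y a)).prod * ∏ i ∈ Finset.range (l'.length + 1), G (k - i)) := by
  induction l' generalizing k with
  | nil =>
    rw [← (Equiv.ofBijective _ (fibreNil_bijective a)).hasSum_iff]
    refine hasSum_of_eq (hG k) (fun n => ?_) (by simp)
    have := blockWeight_replicate_append t r y a k n []
    rw [List.append_nil] at this
    simpa [fibreNil, blockWeight] using this
  | cons b l' ih =>
    have hb : b ≠ a := fun h => hl' (by simp [h])
    rw [← (Equiv.ofBijective _ (fibreCons_bijective hb l')).hasSum_iff]
    have h := ((hG k).mul_of_nonarchimedean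
      (ih (fun h => hl' (List.mem_cons_of_mem _ h)) (k - 1))).mul_left (offWeight t y a b)
    refine hasSum_of_eq h (fun x => ?_) ?_
    · simp only [Function.comp_apply, Equiv.ofBijective_apply, fibreCons]
      rw [blockWeight_replicate_append, blockWeight, if_neg hb]
      ring
    · rw [List.map_cons, List.prod_cons, List.length_cons, Finset.prod_range_succ' _ (l'.length + 1)]
      have : ∀ i : ℕ, k - ((i + 1 : ℕ) : ℤ) = k - 1 - i := fun i => by push_cast; ring
      simp only [this, Nat.cast_zero, sub_zero]
      ring

end Sums

end BlockSum

/-! ### Master sums as sums over balanced families of words. -/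

namespace BlockSum

open AdicSum

/-- The number of letters `b` in all the words is the length of the word with index `b`. -/
def Balanced {N : ℕ} (B : Fin N → List (Fin N)) : Prop :=
  ∀ b, ∑ a, (B a).count b = (B b).length

section Defs

variable {R : Type*} [CommRing R]

theorem finite_sum_length_lt {N : ℕ} (n : ℕ) :
    {B : {B : Fin N → List (Fin N) // Balanced B} | ∑ a, (B.1 a).length < n}.Finite := by
  have h : {B : Fin N → List (Fin N) | ∑ a, (B a).length < n}.Finite := by
    refine (Set.Finite.pi (t := fun _ : Fin N => {l : List (Fin N) | l.length < n})
      fun _ => List.finite_length_lt _ n).subset ?_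
    intro B hB a _
    exact lt_of_le_of_lt (Finset.single_le_sum (f := fun a => (B a).length)
      (fun _ _ => Nat.zero_le _) (Finset.mem_univ a)) hB
  exact h.preimage Subtype.val_injective.injOn

theorem prod_map_mem_pow {N : ℕ} {I : Ideal R} {f : Fin N → R} (hf : ∀ b, f b ∈ I)
    (l : List (Fin N)) : (l.map f).prod ∈ I ^ l.length := by
  induction l with
  | nil => simp
  | cons b l ih =>
    rw [List.map_cons, List.prod_cons, List.length_cons, pow_succ']
    exact Ideal.mul_mem_mul (hf b) ih

theorem prod_mem_pow_sum {N : ℕ} {I : Ideal R} {f : Fin N → R} {d : Fin N → ℕ}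
    (h : ∀ a, f a ∈ I ^ d a) : ∏ a, f a ∈ I ^ ∑ a, d a := by
  rw [← Finset.prod_pow_eq_pow_sum]
  exact Ideal.prod_mem_prod fun a _ => h a

theorem blockWeight_mem_pow {N : ℕ} {I : Ideal R} (t r : R) {y : Fin N → R} (hy : ∀ b, y b ∈ I)
    (a : Fin N) (k : ℤ) (l : List (Fin N)) : blockWeight t r y a k l ∈ I ^ l.length := by
  induction l generalizing k with
  | nil => simp [blockWeight]
  | cons b l ih =>
    rw [blockWeight, List.length_cons, pow_succ']
    split_ifs
    · exact Ideal.mul_mem_mul (I.mul_mem_left _ (hy a)) (ih _)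
    · exact Ideal.mul_mem_mul (I.mul_mem_left _ (hy b)) (ih _)

/-- The exponent vector of a word. -/
theorem sum_single_apply {N k : ℕ} (p : Fin k → Fin N) (b : Fin N) :
    (∑ s, Finsupp.single (p s) 1 : Fin N →₀ ℕ) b = (List.ofFn p).count b := by
  induction k with
  | zero => simp
  | succ k ih =>
    rw [Fin.sum_univ_succ, Finsupp.add_apply, ih, List.ofFn_succ, List.count_cons,
      Finsupp.single_apply, add_comm]
    simp

-- Expanding the power of row a chooses a word of length c a. The coefficient of X^c keeps the
-- families using each letter b exactly c b times.
open Classical in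
theorem masterTerm_eq_sum {N : ℕ} (A : Fin N → Fin N → R) (c : Fin N → ℕ) :
    masterTerm A c = ∑ P : ∀ a, Fin (c a) → Fin N,
      if Balanced (fun a => List.ofFn (P a)) then ∏ a, ((List.ofFn (P a)).map (A a)).prod
      else 0 := by
  have h : ∀ a, (∑ b, MvPolynomial.C (A a b) * MvPolynomial.X b : MvPolynomial (Fin N) R) ^ c a
      = ∑ p : Fin (c a) → Fin N, MvPolynomial.monomial (∑ s, Finsupp.single (p s) 1)
        ((List.ofFn p).map (A a)).prod := by
    intro a
    rw [Fintype.sum_pow]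
    refine Finset.sum_congr rfl fun p _ => ?_
    rw [List.map_ofFn, List.prod_ofFn]
    rw [MvPolynomial.monomial_sum_prod]
    simp [MvPolynomial.C_mul_X_eq_monomial]
  rw [masterTerm]
  simp_rw [h]
  rw [Finset.prod_univ_sum, MvPolynomial.coeff_sum, Fintype.piFinset_univ]
  refine Finset.sum_congr rfl fun P _ => ?_
  rw [← MvPolynomial.monomial_sum_prod, MvPolynomial.coeff_monomial]
  congr 1
  refine propext (DFunLike.ext_iff.trans ?_)
  refine forall_congr' fun b => ?_
  rw [Finsupp.finsetSum_apply]
  simp [sum_single_apply]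

end Defs

section Sums

variable {R : Type*} [CommRing R] [UniformSpace R] [IsUniformAddGroup R] [NonarchimedeanRing R]
  [CompleteSpace R] [T2Space R]

/-- The balanced families whose words have given lengths. -/
def ofFnFamily {N : ℕ} (c : Fin N → ℕ)
    (P : {P : ∀ a, Fin (c a) → Fin N // Balanced (fun a => List.ofFn (P a))}) :
    {B : {B : Fin N → List (Fin N) // Balanced B} // (fun a => (B.1 a).length) = c} :=
  ⟨⟨fun a => List.ofFn (P.1 a), P.2⟩, by simp⟩

theorem ofFnFamily_bijective {N : ℕ} (c : Fin N → ℕ) : Function.Bijective (ofFnFamily c) := by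
  constructor
  · intro P Q h
    refine Subtype.ext (funext fun a => List.ofFn_injective ?_)
    exact congrFun (congrArg (fun x => x.1.1) h) a
  · rintro ⟨⟨B, hB⟩, rfl⟩
    refine ⟨⟨fun a => (B a).get, by simpa using hB⟩, ?_⟩
    simp [ofFnFamily]

theorem hasSum_balanced {N : ℕ} {I : Ideal R} (hI : PowersTendToZero I)
    {A : Fin N → Fin N → R} (hA : ∀ a b, A a b ∈ I) {F : R} (h : HasSum (masterTerm A) F) :
    HasSum (fun B : {B : Fin N → List (Fin N) // Balanced B} =>
      ∏ a, ((B.1 a).map (A a)).prod) F := by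
  classical
  have hs : Summable (fun B : {B : Fin N → List (Fin N) // Balanced B} =>
      ∏ a, ((B.1 a).map (A a)).prod) :=
    summable_of_mem_pow hI _ finite_sum_length_lt
      fun B => prod_mem_pow_sum fun a => prod_map_mem_pow (hA a) _
  have h1 := ((Equiv.sigmaFiberEquiv fun B : {B : Fin N → List (Fin N) // Balanced B} =>
    fun a => (B.1 a).length).hasSum_iff.2 hs.hasSum).sigma (g := masterTerm A) fun c => by
      rw [← (Equiv.ofBijective _ (ofFnFamily_bijective c)).hasSum_iff]
      refine hasSum_of_eq (hasSum_fintype _) (fun P => rfl) ?_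
      rw [masterTerm_eq_sum, ← Finset.sum_filter]
      exact Finset.sum_subtype _ (by simp) _
  rw [← h1.unique h]
  exact hs.hasSum

end Sums

end BlockSum

/-! ### Reduction to blocks free of their own letter. -/

namespace BlockSum

open AdicSum

section Defs

variable {R : Type*} [CommRing R] {N : ℕ}

/-- The family of words obtained by deleting the letters `a` from the word with index `a`. -/
def strip (B : Fin N → List (Fin N)) (a : Fin N) : List (Fin N) := (B a).filter fun b => b ≠ a

theorem count_eq_count_strip (B : Fin N → List (Fin N)) (a b : Fin N) :
    (B a).count b = (strip B a).count b + if a = b then (B b).count b else 0 := by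
  unfold strip
  split_ifs with h
  · subst h
    have : List.count a ((B a).filter fun b => b ≠ a) = 0 := List.count_eq_zero.2 (by simp)
    rw [this, zero_add]
  · rw [List.count_filter (by simpa using Ne.symm h), add_zero]

theorem length_eq_length_strip (B : Fin N → List (Fin N)) (a : Fin N) :
    (B a).length = (strip B a).length + (B a).count a := by
  unfold strip
  generalize B a = l
  induction l with
  | nil => rfl
  | cons b l ih =>
    by_cases h : b = a
    · simp [h] at ih ⊢; omega
    · simp [h] at ih ⊢; omega

/-- Deleting the letters b from the word with index b lowers both sides of the condition at b by the
same number. -/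
theorem balanced_strip_iff (B : Fin N → List (Fin N)) : Balanced (strip B) ↔ Balanced B := by
  refine forall_congr' fun b => ?_
  rw [Finset.sum_congr (s₁ := Finset.univ) (f := fun a => (B a).count b) rfl
    fun a _ => count_eq_count_strip B a b, Finset.sum_add_distrib, Finset.sum_ite_eq', if_pos (Finset.mem_univ b),
    length_eq_length_strip B b, add_left_inj]

theorem notMem_strip (B : Fin N → List (Fin N)) (a : Fin N) : a ∉ strip B a := by
  simp [strip]

/-- The balanced families in which the word with index `a` does not contain `a`. -/
abbrev Deranged (N : ℕ) : Type :=
  {B : {B : Fin N → List (Fin N) // Balanced B} // ∀ a, a ∉ B.1 a}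

/-- Deletion of the letters `a` from the word with index `a`, on balanced families. -/
def stripBalanced (B : {B : Fin N → List (Fin N) // Balanced B}) : Deranged N :=
  ⟨⟨strip B.1, (balanced_strip_iff B.1).2 B.2⟩, notMem_strip B.1⟩

/-- The families of words which reduce to a given family. -/
def fibreEquiv (B' : Deranged N) :
    (∀ a, Fibre a (B'.1.1 a)) ≃
      {B : {B : Fin N → List (Fin N) // Balanced B} // stripBalanced B = B'} where
  toFun e := ⟨⟨fun a => (e a).1, (balanced_strip_iff _).1 (by
      rw [show strip (fun a => (e a).1) = B'.1.1 from funext fun a => (e a).2]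
      exact B'.1.2)⟩,
    Subtype.ext (Subtype.ext (funext fun a => (e a).2))⟩
  invFun B a := ⟨B.1.1 a, congrArg (fun x => x.1.1 a) B.2⟩
  left_inv _ := rfl
  right_inv _ := rfl

/-- The number of letters `a` in the words of smaller index. -/
def countBefore (B : Fin N → List (Fin N)) (a : Fin N) : ℕ := ∑ a' ∈ Finset.Iio a, (B a').count a

/-- The number of letters `a` in the words of larger index. -/
def countAfter (B : Fin N → List (Fin N)) (a : Fin N) : ℕ := ∑ a' ∈ Finset.Ioi a, (B a').count a

theorem countBefore_strip (B : Fin N → List (Fin N)) (a : Fin N) :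
    countBefore (strip B) a = countBefore B a := by
  refine Finset.sum_congr rfl fun a' h => ?_
  rw [count_eq_count_strip B a', if_neg (Finset.mem_Iio.1 h).ne, add_zero]

theorem prod_univ_eq_mul_Iio_Ioi {M : Type*} [CommMonoid M] (f : Fin N → M) (a : Fin N) :
    ∏ b, f b = (∏ b ∈ Finset.Iio a, f b) * f a * ∏ b ∈ Finset.Ioi a, f b := by
  rw [← Finset.prod_mul_prod_compl (Finset.Iic a) f]
  congr 1
  · rw [← Finset.Iio_insert, Finset.prod_insert (by simp), mul_comm]
  · exact Finset.prod_congr (by ext; simp) fun _ _ => rfl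

theorem length_eq_countBefore_add_countAfter (B' : Deranged N) (a : Fin N) :
    (B'.1.1 a).length = countBefore B'.1.1 a + countAfter B'.1.1 a := by
  rw [← B'.1.2 a]
  have := congrArg Multiplicative.toAdd
    (prod_univ_eq_mul_Iio_Ioi (fun b => Multiplicative.ofAdd ((B'.1.1 b).count a)) a)
  simp only [toAdd_prod, toAdd_mul, toAdd_ofAdd] at this
  rw [this, List.count_eq_zero.2 (B'.2 a), add_zero]
  rfl

theorem prod_map_eq_prod_pow_count (f : Fin N → R) (l : List (Fin N)) :
    (l.map f).prod = ∏ b, f b ^ l.count b := by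
  induction l with
  | nil => simp
  | cons c l ih =>
    simp only [List.map_cons, List.prod_cons, ih, List.count_cons, pow_add, beq_iff_eq,
      Finset.prod_mul_distrib]
    rw [mul_comm]
    congr 1
    rw [Finset.prod_eq_single c]
    · simp
    · intro b _ hb
      simp [hb.symm]
    · simp

/-- Regrouping: the factor g₁ b goes to each letter b lying in an earlier block, g₂ b to each one in
a later block. This turns powers depending on the whole family into a product over letters. -/
theorem prod_map_eliminationMatrix (t : R) (y g₁ g₂ : Fin N → R) (B' : Deranged N) :
    ∏ a, ((B'.1.1 a).map (eliminationMatrix 0 (fun b => y b * g₁ b)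
        (fun b => t * y b * g₂ b) a)).prod
      = ∏ a, ((B'.1.1 a).map (offWeight t y a)).prod
        * (g₁ a ^ countBefore B'.1.1 a * g₂ a ^ countAfter B'.1.1 a) := by
  have h : ∀ a, ((B'.1.1 a).map (eliminationMatrix 0 (fun b => y b * g₁ b)
        (fun b => t * y b * g₂ b) a)).prod
      = ((B'.1.1 a).map (offWeight t y a)).prod
        * ∏ b, (if a < b then g₁ b else g₂ b) ^ (B'.1.1 a).count b := by
    intro a
    rw [← prod_map_eq_prod_pow_count, ← List.prod_map_mul]
    congr 1
    refine List.map_congr_left fun b hb => ?_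
    have hba : b ≠ a := fun h => B'.2 a (h ▸ hb)
    rcases lt_or_gt_of_ne hba with h | h
    · simp [eliminationMatrix, offWeight, h, h.not_gt]
    · have h : a < b := h
      simp [eliminationMatrix, offWeight, h, h.not_gt]
  simp_rw [h]
  rw [Finset.prod_mul_distrib, Finset.prod_mul_distrib, Finset.prod_comm]
  congr 1
  refine Finset.prod_congr rfl fun b _ => ?_
  rw [prod_univ_eq_mul_Iio_Ioi _ b, List.count_eq_zero.2 (B'.2 b), pow_zero, mul_one, countBefore,
    countAfter, ← Finset.prod_pow_eq_pow_sum, ← Finset.prod_pow_eq_pow_sum]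
  congr 1
  · refine Finset.prod_congr rfl fun a h => ?_
    rw [if_pos (Finset.mem_Iio.1 h)]
  · refine Finset.prod_congr rfl fun a h => ?_
    rw [if_neg (Finset.mem_Ioi.1 h).not_gt]

end Defs

section Sums

variable {R : Type*} [CommRing R] [UniformSpace R] [IsUniformAddGroup R] [NonarchimedeanRing R]
  [CompleteSpace R] [T2Space R] {N : ℕ}

/-- Group the families by what remains after deletion. By balance the reduced block of a has
`countBefore` + `countAfter` letters, so its runs contribute g₁^countBefore · g₀ · g₂^countAfter. -/
theorem hasSum_blockWeight_balanced {I : Ideal R} (hI : PowersTendToZero I) (t r : R)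
    {y g₁ g₀ g₂ : Fin N → R} (hy : ∀ a, y a ∈ I) (hg₁ : ∀ a, g₁ a * (1 - y a) = 1)
    (hg₀ : ∀ a, g₀ a * (1 - r * y a) = 1) (hg₂ : ∀ a, g₂ a * (1 - t * y a) = 1) {F : R}
    (hF : HasSum (masterTerm (eliminationMatrix 0 (fun b => y b * g₁ b)
      (fun b => t * y b * g₂ b))) F) :
    HasSum (fun B : {B : Fin N → List (Fin N) // Balanced B} =>
      ∏ a, blockWeight t r y a (countBefore B.1 a) (B.1 a)) ((∏ a, g₀ a) * F) := by
  set A := eliminationMatrix 0 (fun b => y b * g₁ b) (fun b => t * y b * g₂ b) with hA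
  have hs : Summable (fun B : {B : Fin N → List (Fin N) // Balanced B} =>
      ∏ a, blockWeight t r y a (countBefore B.1 a) (B.1 a)) :=
    summable_of_mem_pow hI _ finite_sum_length_lt
      fun B => prod_mem_pow_sum fun a => blockWeight_mem_pow t r hy a _ _
  have hAI : ∀ a b, A a b ∈ I := by
    intro a b
    have h1 : y b * g₁ b ∈ I := I.mul_mem_right _ (hy b)
    have h2 : t * y b * g₂ b ∈ I := I.mul_mem_right _ (I.mul_mem_left _ (hy b))
    rw [hA, eliminationMatrix]
    split_ifs
    · exact I.mul_mem_left _ h1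
    · exact I.add_mem h2 (I.mul_mem_left _ h1)
    · exact I.mul_mem_left _ h1
  -- The diagonal of A vanishes since s = 0, so only deranged families contribute to the master sum.
  have hD : HasSum (fun B' : Deranged N => ∏ a, ((B'.1.1 a).map (A a)).prod) F := by
    refine (Function.Injective.hasSum_iff (g := fun B' : Deranged N => B'.1)
      Subtype.val_injective fun B hB => ?_).2 (hasSum_balanced hI hAI hF)
    have : ∃ a, a ∈ B.1 a := by
      by_contra h
      push Not at h
      exact hB ⟨⟨B, h⟩, rfl⟩
    obtain ⟨a, ha⟩ := this
    refine Finset.prod_eq_zero (Finset.mem_univ a) (List.prod_eq_zero ?_)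
    exact List.mem_map.2 ⟨a, ha, by simp [hA, eliminationMatrix]⟩
  let G : Fin N → ℤ → R := fun a k => if 0 < k then g₁ a else if k = 0 then g₀ a else g₂ a
  have hGdef : G = fun a k => if 0 < k then g₁ a else if k = 0 then g₀ a else g₂ a := rfl
  have h1 := ((Equiv.sigmaFiberEquiv (stripBalanced (N := N))).hasSum_iff.2 hs.hasSum).sigma
    (g := fun B' : Deranged N => (∏ a, g₀ a) * ∏ a, ((B'.1.1 a).map (A a)).prod) fun B' => by
      rw [← (fibreEquiv B').hasSum_iff]
      have h2 := hasSum_pi_prod fun a => hasSum_blockWeight_fibre (t := t) (r := r) (y := y)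
        (a := a) (G := G a)
        (fun k => by
          refine hasSum_geometric hI (I.mul_mem_left _ (hy a)) ?_
          simp only [phase, hGdef]
          split_ifs
          · simpa using hg₁ a
          · exact hg₀ a
          · exact hg₂ a) (B'.2 a) (countBefore B'.1.1 a)
      refine hasSum_of_eq h2 (fun e => ?_) ?_
      · have h3 : strip (fun a => (e a).1) = B'.1.1 := funext fun a => (e a).2
        have h4 : ∀ a, countBefore B'.1.1 a = countBefore (fun a => (e a).1) a := fun a =>
          (congrArg (fun B => countBefore B a) h3).symm.trans (countBefore_strip _ a)
        change ∏ a, blockWeight t r y a (countBefore (fun a => (e a).1) a : ℕ) (e a).1 = _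
        exact Finset.prod_congr rfl fun a _ => by rw [h4 a]
      · rw [hA, prod_map_eliminationMatrix, ← Finset.prod_mul_distrib]
        refine Finset.prod_congr rfl fun a _ => ?_
        rw [length_eq_countBefore_add_countAfter, prod_eq_of_sign (G a) (g₁ := g₁ a) (g₀ := g₀ a)
          (g₂ := g₂ a) _ _ (fun i hi => if_pos hi) (by simp [hGdef])
          (fun i hi => by simp only [hGdef]; rw [if_neg hi.not_gt, if_neg hi.ne])]
        ring
  rw [← h1.unique (hD.mul_left _)]
  exact hs.hasSum

end Sums

end BlockSum

/-! ### Words as concatenations of balanced families. -/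

namespace BlockSum

open AdicSum

section Defs

variable {R : Type*} [CommRing R] {N : ℕ}

/-- The concatenation of the words of a balanced family. -/
def concat (B : {B : Fin N → List (Fin N) // Balanced B}) : List (Fin N) :=
  (List.ofFn B.1).flatten

theorem count_concat (B : {B : Fin N → List (Fin N) // Balanced B}) (b : Fin N) :
    (concat B).count b = (B.1 b).length := by
  rw [concat, List.count_flatten, List.map_ofFn, List.sum_ofFn, ← B.2 b]
  rfl

theorem sum_count_eq_length (l : List (Fin N)) : ∑ b, l.count b = l.length := by
  induction l with
  | nil => simp
  | cons c l ih =>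
    simp only [List.count_cons, Finset.sum_add_distrib, ih, List.length_cons]
    simp

/-- Balance makes the block lengths equal to the letter counts of the whole word, so the word itself
tells where to cut. -/
theorem concat_bijective : Function.Bijective (concat (N := N)) := by
  constructor
  · intro B B' h
    refine Subtype.ext (List.ofFn_injective (List.eq_iff_flatten_eq.2 ⟨h, ?_⟩))
    rw [List.map_ofFn, List.map_ofFn]
    congr 1
    funext b
    simp only [Function.comp_apply]
    rw [← count_concat, ← count_concat, h]
  · intro l
    set sz := List.ofFn fun b : Fin N => l.count b with hsz
    have hsum : sz.sum = l.length := by rw [hsz, List.sum_ofFn, sum_count_eq_length]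
    have hlen : (sz.splitLengths l).length = N := by simp [hsz]
    set B : Fin N → List (Fin N) := fun a => (sz.splitLengths l).get (a.cast hlen.symm) with hB
    have hofFn : List.ofFn B = sz.splitLengths l := by
      refine List.ext_get (by simp [hlen]) fun n h1 h2 => ?_
      simp [hB]
    have hflat : (List.ofFn B).flatten = l := by
      rw [hofFn, List.flatten_splitLengths _ _ hsum.ge]
    have hl : ∀ b, (B b).length = l.count b := by
      have h1 : List.ofFn (fun b => (B b).length) = sz := by
        rw [← List.map_splitLengths_length l sz hsum.le, ← hofFn, List.map_ofFn]
        rfl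
      exact fun b => congrFun (List.ofFn_injective (h1.trans hsz)) b
    refine ⟨⟨B, fun b => ?_⟩, hflat⟩
    rw [hl]
    conv_rhs => rw [← hflat]
    rw [List.count_flatten, List.map_ofFn, List.sum_ofFn]
    rfl

/-- The weight of the letters of a word following a word `pre`; the letters `b` are sorted into
the positions starting with `C b`. -/
def scan (t r : R) (y : Fin N → R) (C : Fin N → ℕ) : List (Fin N) → List (Fin N) → R
  | _, [] => 1
  | pre, b :: l => phase t r ((C b + pre.count b : ℕ) - (pre.length : ℤ)) * y b
      * scan t r y C (pre ++ [b]) l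

theorem scan_append (t r : R) (y : Fin N → R) (C : Fin N → ℕ) (pre l l' : List (Fin N)) :
    scan t r y C pre (l ++ l') = scan t r y C pre l * scan t r y C (pre ++ l) l' := by
  induction l generalizing pre with
  | nil => simp [scan]
  | cons b l ih =>
    rw [List.cons_append, scan, ih, scan, List.append_assoc, mul_assoc, mul_assoc, mul_assoc]
    rfl

/-- In the block of `a`, the weight of a word is its block weight. -/
theorem scan_eq_blockWeight (t r : R) (y : Fin N → R) {C c : Fin N → ℕ}
    (hC : ∀ a b, a < b → C a + c a ≤ C b) (a : Fin N) (pre l : List (Fin N))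
    (h₁ : C a ≤ pre.length) (h₂ : pre.length + l.length ≤ C a + c a)
    (h₃ : ∀ b, (pre ++ l).count b ≤ c b) :
    scan t r y C pre l
      = blockWeight t r y a ((C a + pre.count a : ℕ) - (pre.length : ℤ)) l := by
  induction l generalizing pre with
  | nil => rfl
  | cons b l ih =>
    rw [List.length_cons] at h₂
    have h3 := h₃ b
    rw [List.count_append, List.count_cons_self] at h3
    rw [scan, blockWeight, ih (pre ++ [b]) (by simp; omega) (by simp; omega)
      (by simpa using h₃)]
    rcases lt_trichotomy b a with h | rfl | h
    · have := hC b a h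
      rw [if_neg h.ne, offWeight, if_pos h, phase, if_neg (by omega), if_neg (by omega)]
      congr 2
      simp [h.ne]; omega
    · rw [if_pos rfl]
      congr 2
      simp; omega
    · have := hC a b h
      rw [if_neg h.ne', offWeight, if_neg h.not_gt, phase, if_pos (by omega)]
      congr 2
      simp [h.ne']; omega

/-- The number of letters smaller than `b`, for a word with the multiplicities `c`. -/
def start (c : Fin N → ℕ) (b : Fin N) : ℕ := ∑ a ∈ Finset.Iio b, c a

theorem start_add_le (c : Fin N → ℕ) (a b : Fin N) (h : a < b) : start c a + c a ≤ start c b := by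
  rw [start, add_comm, ← Finset.sum_insert (by simp), Finset.Iio_insert]
  exact Finset.sum_le_sum_of_subset fun x hx =>
    Finset.mem_Iio.2 ((Finset.mem_Iic.1 hx).trans_lt h)

theorem scan_concat (t r : R) (y : Fin N → R) (B : {B : Fin N → List (Fin N) // Balanced B}) :
    scan t r y (start fun b => (concat B).count b) [] (concat B)
      = ∏ a, blockWeight t r y a (countBefore B.1 a) (B.1 a) := by
  simp only [count_concat]
  set c : Fin N → ℕ := fun b => (B.1 b).length with hc
  -- Induction on the number of blocks read. The length locates the start of the next block, and the
  -- counts give its initial phase.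
  have key : ∀ m ≤ N, scan t r y (start c) [] ((List.ofFn B.1).take m).flatten
        = ∏ a with a.val < m, blockWeight t r y a (countBefore B.1 a) (B.1 a)
      ∧ ((List.ofFn B.1).take m).flatten.length = ∑ a with a.val < m, c a
      ∧ ∀ b, ((List.ofFn B.1).take m).flatten.count b = ∑ a with a.val < m, (B.1 a).count b := by
    intro m
    induction m with
    | zero => simp [scan]
    | succ m ih =>
      intro hm
      obtain ⟨ih1, ih2, ih3⟩ := ih (by omega)
      set a : Fin N := ⟨m, hm⟩ with ha
      have hflat : ((List.ofFn B.1).take (m + 1)).flatten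
          = ((List.ofFn B.1).take m).flatten ++ B.1 a := by
        rw [List.take_succ_eq_append_getElem (by simpa using hm), List.flatten_append]
        simp [ha]
      have hset : (Finset.univ.filter fun b : Fin N => b.val < m + 1)
          = insert a (Finset.univ.filter fun b : Fin N => b.val < m) := by
        ext b
        simp [ha, Fin.ext_iff]
        omega
      have hIio : (Finset.univ.filter fun b : Fin N => b.val < m) = Finset.Iio a := by
        ext b
        simp [ha, Fin.lt_def]
      have hnot : a ∉ Finset.univ.filter fun b : Fin N => b.val < m := by simp [ha]
      have hlen : ((List.ofFn B.1).take m).flatten.length = start c a := by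
        rw [ih2, hIio, start]
      refine ⟨?_, ?_, fun b => ?_⟩
      · rw [hflat, scan_append, ih1, hset, Finset.prod_insert hnot, mul_comm, List.nil_append,
          scan_eq_blockWeight t r y (start_add_le c) a _ _ hlen.ge
            (by rw [hlen]) fun b => ?_]
        · rw [hlen, ih3, hIio, countBefore]
          congr 2
          push_cast
          ring
        · rw [← hflat, show c b = _ from (count_concat B b).symm]
          refine List.Sublist.count_le b ?_
          exact (List.take_sublist _ _).flatten
      · rw [hflat, List.length_append, ih2, hset, Finset.sum_insert hnot, add_comm]
      · rw [hflat, List.count_append, ih3, hset, Finset.sum_insert hnot, add_comm]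
  have h := (key N le_rfl).1
  rw [List.take_of_length_le (by simp)] at h
  rw [concat, h]
  exact Finset.prod_congr (by simp) fun _ _ => rfl

end Defs

end BlockSum

/-! ### Excedances and fixed points of the sorting permutation. -/

namespace BlockSum

open AdicSum

variable {R : Type*} [CommRing R] {N : ℕ}

theorem count_ofFn_eq_card {n : ℕ} (w : Fin n → Fin N) (b : Fin N) :
    (List.ofFn w).count b = (Finset.univ.filter fun i => w i = b).card := by
  induction n with
  | zero => simp
  | succ n ih =>
    rw [List.ofFn_succ, List.count_cons, ih, Fin.card_filter_univ_succ]
    simp only [beq_iff_eq]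
    split_ifs <;> rfl

theorem start_count_ofFn {n : ℕ} (w : Fin n → Fin N) (x : Fin N) :
    start (fun b => (List.ofFn w).count b) x = (Finset.univ.filter fun i => w i < x).card := by
  rw [start, Finset.card_eq_sum_card_fiberwise (f := w) (t := Finset.Iio x)
    (fun i hi => by simpa using hi)]
  refine Finset.sum_congr rfl fun b hb => ?_
  rw [count_ofFn_eq_card, Finset.filter_filter]
  congr 1
  ext i
  simp only [Finset.mem_filter, Finset.mem_univ, true_and]
  exact ⟨fun h => ⟨h ▸ Finset.mem_Iio.1 hb, h⟩, fun h => h.2⟩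

theorem scan_ofFn (t r : R) (y : Fin N → R) (C : Fin N → ℕ) {n : ℕ} (pre : List (Fin N))
    (w : Fin n → Fin N) :
    scan t r y C pre (List.ofFn w)
      = ∏ j, phase t r ((C (w j) + pre.count (w j)
          + (Finset.univ.filter fun i => i < j ∧ w i = w j).card : ℕ)
          - ((pre.length + j : ℕ) : ℤ)) * y (w j) := by
  induction n generalizing pre with
  | zero => simp [scan]
  | succ n ih =>
    rw [List.ofFn_succ, scan, ih, Fin.prod_univ_succ]
    congr 1
    · simp
    · refine Finset.prod_congr rfl fun j _ => ?_
      congr 2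
      rw [Fin.card_filter_univ_succ]
      simp only [Fin.succ_pos, true_and, List.count_append, List.count_singleton, beq_iff_eq,
        Fin.succ_lt_succ_iff, List.length_append, List.length_singleton,
        Fin.val_succ]
      split_ifs <;> push_cast <;> ring

/-- The position of `j` in the stable sorting of `w`. -/
theorem sort_symm_apply {n : ℕ} (w : Fin n → Fin N) (j : Fin n) :
    ((Tuple.sort w).symm j : ℕ) = (Finset.univ.filter fun i => w i < w j).card
      + (Finset.univ.filter fun i => i < j ∧ w i = w j).card := by
  obtain ⟨hmono, hstable⟩ := Tuple.eq_sort_iff.1 (rfl : Tuple.sort w = Tuple.sort w)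
  set σ := Tuple.sort w with hσ
  rw [← Finset.card_union_of_disjoint (Finset.disjoint_filter.2 fun i _ h h' => h.ne h'.2),
    ← Fin.card_Iio, ← Finset.card_map σ.toEmbedding]
  congr 1
  ext i
  simp only [Finset.mem_map_equiv, Finset.mem_Iio, Finset.mem_union, Finset.mem_filter,
    Finset.mem_univ, true_and]
  have h1 : ∀ i j, σ.symm i < σ.symm j → w i < w j ∨ i < j ∧ w i = w j := by
    intro i j h
    have h2 := hmono h.le
    simp only [Function.comp_apply, Equiv.apply_symm_apply] at h2
    rcases h2.lt_or_eq with h2 | h2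
    · exact Or.inl h2
    · have h3 := hstable _ _ h (by simpa using h2)
      exact Or.inr ⟨by simpa using h3, h2⟩
  refine ⟨h1 i j, fun h => ?_⟩
  rcases lt_trichotomy (σ.symm i) (σ.symm j) with h2 | h2 | h2
  · exact h2
  · have := σ.symm.injective h2
    subst this
    simp at h
  · rcases h1 j i h2 with h3 | h3
    · rcases h with h | h
      · exact absurd h3 h.not_gt
      · exact absurd h.2 h3.ne'
    · rcases h with h | h
      · exact absurd h3.2 h.ne'
      · exact absurd h3.1 h.1.not_gt

/-- The letter at position j = σ i has sorted position i, so a negative phase argument means i < σ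
i. -/
theorem prod_phase_perm (t r : R) {n : ℕ} (σ : Equiv.Perm (Fin n)) :
    ∏ j, phase t r ((σ.symm j : ℤ) - (j : ℤ)) = t ^ PermStat.exc σ * r ^ PermStat.fix σ := by
  rw [← Equiv.prod_comp σ]
  have h : ∀ i : Fin n, phase t r (((σ.symm (σ i) : Fin n) : ℤ) - ((σ i : Fin n) : ℤ))
      = (if i < σ i then t else 1) * (if σ i = i then r else 1) := by
    intro i
    rw [Equiv.symm_apply_apply, phase]
    rcases lt_trichotomy i (σ i) with h | h | h
    · rw [if_pos h, if_neg h.ne', mul_one, if_neg (by omega), if_neg (by omega)]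
    · rw [← h]; simp
    · rw [if_neg h.not_gt, if_neg h.ne, mul_one, if_pos (by omega)]
  simp_rw [h]
  rw [Finset.prod_mul_distrib, Finset.prod_ite, Finset.prod_ite]
  simp [PermStat.exc, PermStat.fix]

theorem scan_ofFn_eq_sort (t r : R) (y : Fin N → R) {n : ℕ} (w : Fin n → Fin N) :
    scan t r y (start fun b => (List.ofFn w).count b) [] (List.ofFn w)
      = t ^ PermStat.exc (Tuple.sort w) * r ^ PermStat.fix (Tuple.sort w) * ∏ j, y (w j) := by
  rw [scan_ofFn, Finset.prod_mul_distrib, ← prod_phase_perm]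
  congr 1
  refine Finset.prod_congr rfl fun j _ => ?_
  rw [start_count_ofFn, sort_symm_apply]
  simp

section Sums

variable [UniformSpace R] [IsUniformAddGroup R] [NonarchimedeanRing R] [CompleteSpace R] [T2Space R]

/-- The sum over all words, weighted by the excedances and fixed points of their sorting. -/
theorem hasSum_words {I : Ideal R} (hI : PowersTendToZero I) (t r : R)
    {y g₁ g₀ g₂ : Fin N → R} (hy : ∀ a, y a ∈ I) (hg₁ : ∀ a, g₁ a * (1 - y a) = 1)
    (hg₀ : ∀ a, g₀ a * (1 - r * y a) = 1) (hg₂ : ∀ a, g₂ a * (1 - t * y a) = 1) {F : R}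
    (hF : F * (∏ a, g₁ a
      - mixedSum (fun b => y b * g₁ b) (fun b => t * y b * g₂ b)) = 1) :
    HasSum (fun w : Σ n, Fin n → Fin N =>
      t ^ PermStat.exc (Tuple.sort w.2) * r ^ PermStat.fix (Tuple.sort w.2) * ∏ j, y (w.2 j))
      ((∏ a, g₀ a) * F) := by
  have hF' : HasSum (masterTerm (eliminationMatrix 0 (fun b => y b * g₁ b)
      (fun b => t * y b * g₂ b))) F := by
    refine hasSum_masterTerm_eliminationMatrix hI 0 (fun a => I.mul_mem_right _ (hy a))
      (fun a => I.mul_mem_right _ (I.mul_mem_left _ (hy a))) ?_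
    have hg : ∀ a, 1 + y a * g₁ a = g₁ a := fun a => by linear_combination -hg₁ a
    simp only [hg]
    rw [add_zero, one_mul, hF]
  have h := hasSum_blockWeight_balanced hI t r hy hg₁ hg₀ hg₂ hF'
  rw [← ((Equiv.ofBijective _ (concat_bijective (N := N))).trans
    List.equivSigmaTuple).hasSum_iff]
  refine hasSum_of_eq h (fun B => ?_) rfl
  rw [← scan_concat]
  refine (scan_ofFn_eq_sort t r y (List.equivSigmaTuple (concat B)).2).symm.trans ?_
  have : List.ofFn (List.equivSigmaTuple (concat B)).2 = concat B :=
    List.equivSigmaTuple.symm_apply_apply (concat B)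
  rw [this]

end Sums

end BlockSum

/-! ### Words as permutations with gap sequences. -/

namespace MajDes

open AdicSum

section PartialSums

/-- The partial sums of a finite sequence. -/
def partialSum {n : ℕ} (f : Fin (n + 1) → ℕ) (j : Fin (n + 1)) : ℕ := ∑ i ∈ Finset.Iic j, f i

theorem partialSum_zero {n : ℕ} (f : Fin (n + 1) → ℕ) : partialSum f 0 = f 0 := by
  rw [partialSum, show Finset.Iic (0 : Fin (n + 1)) = {0} by ext; simp, Finset.sum_singleton]

theorem partialSum_succ {n : ℕ} (f : Fin (n + 1) → ℕ) (i : Fin n) :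
    partialSum f i.succ = partialSum f i.castSucc + f i.succ := by
  have : Finset.Iic i.succ = insert i.succ (Finset.Iic i.castSucc) := by
    ext j
    simp only [Finset.mem_Iic, Finset.mem_insert, Fin.le_def, Fin.ext_iff, Fin.val_succ,
      Fin.val_castSucc]
    omega
  rw [partialSum, this, Finset.sum_insert (by simp), add_comm]
  rfl

theorem partialSum_mono {n : ℕ} (f : Fin (n + 1) → ℕ) : Monotone (partialSum f) := fun _ _ h =>
  Finset.sum_le_sum_of_subset (Finset.Iic_subset_Iic.2 h)

theorem partialSum_injective {n : ℕ} :
    Function.Injective (partialSum : (Fin (n + 1) → ℕ) → Fin (n + 1) → ℕ) := by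
  intro f g h
  funext j
  refine Fin.cases ?_ (fun i => ?_) j
  · rw [← partialSum_zero f, h, partialSum_zero]
  · have h1 := partialSum_succ f i
    rw [h, partialSum_succ] at h1
    omega

theorem exists_partialSum_eq {n : ℕ} {b : Fin (n + 1) → ℕ} (hb : Monotone b) :
    ∃ f, partialSum f = b := by
  refine ⟨Fin.cons (b 0) fun i => b i.succ - b i.castSucc, funext fun j => ?_⟩
  refine Fin.induction ?_ (fun i ih => ?_) j
  · rw [partialSum_zero, Fin.cons_zero]
  · rw [partialSum_succ, ih, Fin.cons_succ]
    have := hb (Fin.castSucc_lt_succ (i := i)).le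
    omega

theorem sum_last_sub_partialSum {n : ℕ} (f : Fin (n + 1) → ℕ) :
    ∑ i : Fin n, (partialSum f (Fin.last n) - partialSum f i.castSucc)
      = ∑ j : Fin (n + 1), (j : ℕ) * f j := by
  have h : ∀ i : Fin n, partialSum f (Fin.last n) - partialSum f i.castSucc
      = ∑ j, if i.castSucc < j then f j else 0 := by
    intro i
    rw [← Finset.sum_filter, Nat.sub_eq_iff_eq_add (partialSum_mono f (Fin.le_last _)),
      partialSum, partialSum, ← Finset.sum_union (Finset.disjoint_left.2 fun j h h' => by
        simp at h h'; exact absurd h h'.not_gt)]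
    congr 1
    ext j
    simp [lt_or_ge, Fin.le_last]
  simp_rw [h]
  rw [Finset.sum_comm]
  refine Finset.sum_congr rfl fun j _ => ?_
  rw [← Finset.sum_filter, Finset.sum_const, smul_eq_mul]
  congr 1
  rw [← Fin.card_Iio j, ← Finset.card_map Fin.castSuccEmb]
  congr 1
  ext k
  simp only [Finset.mem_map, Finset.mem_filter, Finset.mem_univ, true_and, Finset.mem_Iio]
  constructor
  · rintro ⟨i, hi, rfl⟩
    exact hi
  · intro hk
    exact ⟨k.castLT (by have := j.2; have : k.val < j.val := hk; omega), hk, by simp⟩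

end PartialSums

section Sorting

variable {n : ℕ}

/-- The indicator of the descents of `σ`, at their one-based positions. -/
def descentIndicator (σ : Equiv.Perm (Fin n)) : Fin (n + 1) → ℕ :=
  Fin.cons 0 fun i => if i ∈ PermStat.Des σ then 1 else 0

theorem sum_descentIndicator (σ : Equiv.Perm (Fin n)) :
    ∑ j, descentIndicator σ j = PermStat.des σ := by
  simp [Fin.sum_univ_succ, descentIndicator, PermStat.des]

theorem sum_mul_descentIndicator (σ : Equiv.Perm (Fin n)) :
    ∑ j : Fin (n + 1), (j : ℕ) * descentIndicator σ j = PermStat.maj σ := by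
  simp [Fin.sum_univ_succ, descentIndicator, PermStat.maj]

/-- The sorted sequence with given gaps between consecutive terms, not counting the gaps
forced by the descents of `σ`; its last term is an upper bound. -/
def sortedSeq (x : Equiv.Perm (Fin n) × (Fin (n + 1) → ℕ)) : Fin (n + 1) → ℕ :=
  partialSum fun j => x.2 j + descentIndicator x.1 j

/-- The word with letters `0, …, m` which `σ` sorts into the sorted sequence with given gaps,
of which `m` is the last term. -/
def word (x : Equiv.Perm (Fin n) × (Fin (n + 1) → ℕ)) : Σ m, Fin n → Fin (m + 1) :=
  ⟨sortedSeq x (Fin.last n), fun i => ⟨sortedSeq x (x.1.symm i).castSucc,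
    Nat.lt_succ_of_le (partialSum_mono _ (Fin.le_last _))⟩⟩

theorem apply_lt_apply_of_forall_notMem_des {σ : Equiv.Perm (Fin n)} {i j : Fin n} (hij : i < j)
    (h : ∀ k, i ≤ k → k < j → k ∉ PermStat.Des σ) : σ i < σ j := by
  obtain ⟨j, hj⟩ := j
  induction j with
  | zero => exact absurd hij (by simp [Fin.lt_def])
  | succ j ih =>
    have hj' : j < n := by omega
    have hstep : σ ⟨j, hj'⟩ < σ ⟨j + 1, hj⟩ := by
      have h1 := h ⟨j, hj'⟩ (by rw [Fin.lt_def] at hij; rw [Fin.le_def]; simp at hij ⊢; omega)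
        (by simp [Fin.lt_def])
      simp only [PermStat.Des, Finset.mem_filter, Finset.mem_univ, true_and, not_exists,
        not_lt] at h1
      refine lt_of_le_of_ne (h1 hj) fun h2 => ?_
      simpa using σ.injective h2
    rcases (show i.val ≤ j by rw [Fin.lt_def] at hij; simp at hij; omega).eq_or_lt with h1 | h1
    · have : i = ⟨j, hj'⟩ := Fin.ext h1
      rwa [this]
    · exact (ih hj' h1 fun k hk hk' => h k hk (hk'.trans (by simp [Fin.lt_def]))).trans hstep

/-- Each descent forces a strict increase of the sorted sequence, so σ is increasing on every
stretch of equal letters; this is stability. -/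
theorem sort_word (x : Equiv.Perm (Fin n) × (Fin (n + 1) → ℕ)) : Tuple.sort (word x).2 = x.1 := by
  symm
  have hval : ∀ i, ((word x).2 (x.1 i) : ℕ) = sortedSeq x i.castSucc := fun i => by simp [word]
  refine Tuple.eq_sort_iff.2 ⟨fun i j hij => ?_, fun i j hij h => ?_⟩
  · rw [Fin.le_def]
    simp only [Function.comp_apply, hval]
    exact partialSum_mono _ (by simpa using hij)
  · refine apply_lt_apply_of_forall_notMem_des hij fun k hik hkj hk => ?_
    have h1 : sortedSeq x i.castSucc = sortedSeq x j.castSucc := by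
      rw [← hval, ← hval, h]
    have h2 : sortedSeq x i.castSucc ≤ sortedSeq x k.castSucc := partialSum_mono _ (by simpa using hik)
    have h3 : sortedSeq x k.succ ≤ sortedSeq x j.castSucc := partialSum_mono _ (by
      rw [Fin.le_def]; rw [Fin.lt_def] at hkj; simpa using hkj)
    have h4 := partialSum_succ (fun j => x.2 j + descentIndicator x.1 j) k
    simp only [descentIndicator, Fin.cons_succ, if_pos hk] at h4
    change sortedSeq x k.succ = sortedSeq x k.castSucc + _ at h4
    omega

theorem word_injective : Function.Injective (word (n := n)) := by
  intro x x' h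
  have hσ : x.1 = x'.1 := by rw [← sort_word x, ← sort_word x', h]
  obtain ⟨σ, δ⟩ := x
  obtain ⟨σ', δ'⟩ := x'
  simp only at hσ
  subst hσ
  have h1 : sortedSeq (σ, δ) = sortedSeq (σ, δ') := by
    funext j
    refine Fin.lastCases ?_ (fun i => ?_) j
    · exact congrArg Sigma.fst h
    · have := congrFun (congrArg (fun y : Σ m, Fin n → Fin (m + 1) => fun i => (y.2 i : ℕ)) h) (σ i)
      simpa [word] using this
  have h2 := partialSum_injective h1
  have : δ = δ' := funext fun j => by
    have := congrFun h2 j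
    simpa using this
  rw [this]

theorem sigma_word_ext {y y' : Σ m, Fin n → Fin (m + 1)} (h : y.1 = y'.1)
    (h' : ∀ i, (y.2 i : ℕ) = y'.2 i) : y = y' := by
  obtain ⟨m, w⟩ := y
  obtain ⟨m', w'⟩ := y'
  simp only at h
  subst h
  have : w = w' := funext fun i => Fin.ext (h' i)
  rw [this]

theorem word_surjective : Function.Surjective (word (n := n)) := by
  rintro ⟨m, w⟩
  obtain ⟨hmono, hstable⟩ := Tuple.eq_sort_iff.1 (rfl : Tuple.sort w = Tuple.sort w)
  set σ := Tuple.sort w with hσ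
  -- Appending m makes the distance from the largest letter to the bound the last gap.
  set b : Fin (n + 1) → ℕ := Fin.snoc (fun i => (w (σ i) : ℕ)) m with hb
  have hbm : Monotone b := by
    intro i j
    refine Fin.lastCases (fun _ => ?_) (fun j => Fin.lastCases (fun h => ?_) (fun i h => ?_) i) j
    · refine Fin.lastCases le_rfl (fun i => ?_) i
      simp only [hb, Fin.snoc_castSucc, Fin.snoc_last]
      omega
    · exact absurd (h.trans_lt (Fin.castSucc_lt_last j)) (lt_irrefl _)
    · simp only [hb, Fin.snoc_castSucc]
      exact hmono (by simpa using h)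
  obtain ⟨f, hf⟩ := exists_partialSum_eq hbm
  have hle : ∀ j, descentIndicator σ j ≤ f j := by
    intro j
    refine Fin.cases (by simp [descentIndicator]) (fun i => ?_) j
    rw [descentIndicator, Fin.cons_succ]
    split_ifs with hi
    · have h1 := partialSum_succ f i
      rw [hf] at h1
      obtain ⟨h2, h3⟩ : ∃ h : (i : ℕ) + 1 < n, σ ⟨(i : ℕ) + 1, h⟩ < σ i := by
        simpa [PermStat.Des] using hi
      have h4 : i.succ = (⟨(i : ℕ) + 1, h2⟩ : Fin n).castSucc := rfl
      have h5 : i < ⟨(i : ℕ) + 1, h2⟩ := by simp [Fin.lt_def]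
      -- Equal letters at a descent would contradict stability, so the gap there is at least one.
      have h6 : b i.castSucc ≠ b i.succ := by
        rw [h4]
        simp only [hb, Fin.snoc_castSucc]
        intro h7
        exact absurd (hstable _ _ h5 (Fin.ext h7)) h3.not_gt
      have := hbm (Fin.castSucc_lt_succ (i := i)).le
      omega
    · exact Nat.zero_le _
  have hs : sortedSeq (σ, fun j => f j - descentIndicator σ j) = b := by
    rw [← hf, sortedSeq]
    congr 1
    funext j
    have := hle j
    simp only
    omega
  refine ⟨(σ, fun j => f j - descentIndicator σ j), sigma_word_ext ?_ fun i => ?_⟩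
  · simp [word, hs, hb]
  · simp [word, hs, hb]

end Sorting

section Sums

variable {R : Type*} [CommRing R]

/-- The contribution of a word with letters `0, …, m`. -/
def wordTerm (q p t r z : R) (m n : ℕ) (w : Fin n → Fin (m + 1)) : R :=
  p ^ m * (t ^ PermStat.exc (Tuple.sort w) * r ^ PermStat.fix (Tuple.sort w)
    * ∏ j, (z * q ^ (m - (w j : ℕ))))

theorem wordTerm_word (q p t r z : R) {n : ℕ} (x : Equiv.Perm (Fin n) × (Fin (n + 1) → ℕ)) :
    wordTerm q p t r z (word x).1 n (word x).2
      = z ^ n * ((q ^ PermStat.maj x.1 * p ^ PermStat.des x.1 * t ^ PermStat.exc x.1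
          * r ^ PermStat.fix x.1) * ∏ j : Fin (n + 1), (p * q ^ (j : ℕ)) ^ x.2 j) := by
  rw [wordTerm, sort_word, Finset.prod_mul_distrib, Finset.prod_const, Finset.card_univ,
    Fintype.card_fin, Finset.prod_pow_eq_pow_sum]
  have h1 : ∑ i, ((word x).1 - ((word x).2 i : ℕ)) = PermStat.maj x.1 + ∑ j : Fin (n + 1), (j : ℕ) * x.2 j := by
    rw [← Equiv.sum_comp x.1]
    have : ∀ i, (word x).1 - ((word x).2 (x.1 i) : ℕ)
        = sortedSeq x (Fin.last n) - sortedSeq x i.castSucc := fun i => by simp [word]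
    simp_rw [this]
    rw [sortedSeq, sum_last_sub_partialSum]
    simp only [mul_add, Finset.sum_add_distrib]
    rw [sum_mul_descentIndicator, add_comm]
  have h2 : (word x).1 = PermStat.des x.1 + ∑ j, x.2 j := by
    change sortedSeq x (Fin.last n) = _
    rw [sortedSeq, partialSum, show Finset.Iic (Fin.last n) = Finset.univ by ext; simp [Fin.le_last],
      Finset.sum_add_distrib, sum_descentIndicator, add_comm]
  rw [h1, h2]
  simp only [mul_pow, Finset.prod_mul_distrib, ← pow_mul, Finset.prod_pow_eq_pow_sum, pow_add]
  ring

variable [UniformSpace R] [IsUniformAddGroup R] [NonarchimedeanRing R] [CompleteSpace R] [T2Space R]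

theorem hasSum_wordTerm {I : Ideal R} (hI : PowersTendToZero I) (q p t r z : R) (hp : p ∈ I)
    (n : ℕ) {h : ℕ → R} (hh : ∀ j, h j * (1 - p * q ^ j) = 1) :
    HasSum (fun y : Σ m, Fin n → Fin (m + 1) => wordTerm q p t r z y.1 n y.2)
      (PermStat.enumerator n q p t r * (z ^ n * ∏ j : Fin (n + 1), h j)) := by
  rw [← (Equiv.ofBijective _ ⟨word_injective (n := n), word_surjective⟩).hasSum_iff]
  have h1 := hasSum_fintype fun σ : Equiv.Perm (Fin n) =>
    q ^ PermStat.maj σ * p ^ PermStat.des σ * t ^ PermStat.exc σ * r ^ PermStat.fix σ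
  have h2 := hasSum_pi_prod fun j : Fin (n + 1) =>
    hasSum_geometric hI (I.mul_mem_right (q ^ (j : ℕ)) hp) (hh j)
  refine hasSum_of_eq ((h1.mul_of_nonarchimedean h2).mul_left (z ^ n)) (fun x => ?_) ?_
  · exact wordTerm_word q p t r z x
  · rw [PermStat.enumerator]
    ring

end Sums

end MajDes

/-! ### Geometric letter weights and the double summation. -/

namespace MajDes

open AdicSum BlockSum

section Algebra

variable {R : Type*} [CommRing R]

theorem prod_qPoch_eq_one {a q : R} {G : ℕ → R} (hG : ∀ i, G i * (1 - a * q ^ i) = 1) (n : ℕ) :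
    (∏ i ∈ Finset.range n, G i) * qPoch a q n = 1 := by
  rw [qPoch, ← Finset.prod_mul_distrib]
  exact Finset.prod_eq_one fun i _ => hG i

theorem prod_fin_reflect (G : ℕ → R) (m : ℕ) :
    ∏ a : Fin (m + 1), G (m - a) = ∏ i ∈ Finset.range (m + 1), G i := by
  rw [← Finset.prod_range_reflect, Finset.prod_range]
  exact Finset.prod_congr rfl fun a _ => by simp

/-- With x = z q^i, 1/(1-x) - 1/(1-tqx) = (1-tq) x/((1-x)(1-tqx)). Hence 1 - tq times the sum
telescopes, up to the term of the letter 0. -/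
theorem mixedSum_geometric {q t z : R} {G₁ G₂ : ℕ → R} (h₁ : ∀ i, G₁ i * (1 - z * q ^ i) = 1)
    (h₂ : ∀ i, G₂ i * (1 - t * (z * q ^ i)) = 1) (m : ℕ) :
    (1 - t * q) * mixedSum (fun a : Fin (m + 1) => z * q ^ (m - (a : ℕ)) * G₁ (m - a))
        (fun a => t * (z * q ^ (m - (a : ℕ))) * G₂ (m - a))
      = (1 - t * q) * ∏ i ∈ Finset.range (m + 1), G₁ i
        - ∏ i ∈ Finset.range m, G₂ (i + 1) + t * q * ∏ i ∈ Finset.range m, G₁ i := by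
  induction m with
  | zero =>
    have := h₁ 0
    simp [mixedSum] at this ⊢
    linear_combination (t * q - 1) * this
  | succ m ih =>
    rw [mixedSum]
    have htail₁ : Fin.tail (fun a : Fin (m + 1 + 1) => z * q ^ (m + 1 - (a : ℕ)) * G₁ (m + 1 - a))
        = fun a : Fin (m + 1) => z * q ^ (m - (a : ℕ)) * G₁ (m - a) := by
      funext a; simp [Fin.tail]
    have htail₂ : Fin.tail (fun a : Fin (m + 1 + 1) =>
          t * (z * q ^ (m + 1 - (a : ℕ))) * G₂ (m + 1 - a))
        = fun a : Fin (m + 1) => t * (z * q ^ (m - (a : ℕ))) * G₂ (m - a) := by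
      funext a; simp [Fin.tail]
    have hprod : ∏ a : Fin (m + 1), (1 + z * q ^ (m + 1 - (a.succ : ℕ)) * G₁ (m + 1 - a.succ))
        = ∏ i ∈ Finset.range (m + 1), G₁ i := by
      rw [← prod_fin_reflect]
      refine Finset.prod_congr rfl fun a _ => ?_
      rw [Fin.val_succ, Nat.add_sub_add_right]
      linear_combination -h₁ (m - a)
    rw [htail₁, htail₂, hprod]
    simp only [Fin.val_zero, Nat.sub_zero]
    rw [Finset.prod_range_succ _ (m + 1), Finset.prod_range_succ (fun i => G₂ (i + 1)) m]
    have h3 := h₁ (m + 1)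
    have h4 := h₂ (m + 1)
    have h5 : ∏ i ∈ Finset.range m, G₁ i = (∏ i ∈ Finset.range (m + 1), G₁ i) * (1 - z * q ^ m) := by
      rw [Finset.prod_range_succ, mul_assoc, h₁, mul_one]
    rw [h5] at ih
    generalize ∏ i ∈ Finset.range (m + 1), G₁ i = P at *
    generalize ∏ i ∈ Finset.range m, G₂ (i + 1) = Q at *
    generalize mixedSum (R := R) (N := m + 1) _ _ = M at *
    generalize G₁ (m + 1) = G at *
    generalize G₂ (m + 1) = H at *
    rw [pow_succ] at *
    linear_combination H * ih + (t * q * P - P) * h3 + (P - (1 - t * q) * M) * h4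

theorem wordTerm_mem_pow {I : Ideal R} (q : R) {p : R} (t r : R) {z : R} (hp : p ∈ I) (hz : z ∈ I)
    (m n : ℕ) (w : Fin n → Fin (m + 1)) : wordTerm q p t r z m n w ∈ I ^ (m + n) := by
  rw [pow_add, wordTerm]
  refine Ideal.mul_mem_mul (Ideal.pow_mem_pow hp m) (Ideal.mul_mem_left _ _ ?_)
  have h := prod_mem_pow_sum (I := I) (f := fun j : Fin n => z * q ^ (m - (w j : ℕ)))
    (d := fun _ => 1) (fun j => by rw [pow_one]; exact I.mul_mem_right _ hz)
  simpa using h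

theorem finite_words (k : ℕ) :
    {x : Σ m, Σ n, Fin n → Fin (m + 1) | x.1 + x.2.1 < k}.Finite := by
  refine (Set.finite_range fun x : Σ m : Fin k, Σ n : Fin k, Fin n → Fin (m + 1) =>
    (⟨x.1, x.2.1, x.2.2⟩ : Σ m, Σ n, Fin n → Fin (m + 1))).subset ?_
  rintro ⟨m, n, w⟩ h
  simp only [Set.mem_ofPred_eq] at h
  exact ⟨⟨⟨m, by omega⟩, ⟨n, by omega⟩, w⟩, rfl⟩

end Algebra

section Sums

variable {R : Type*} [CommRing R] [UniformSpace R] [IsUniformAddGroup R] [NonarchimedeanRing R]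
  [CompleteSpace R] [T2Space R]

/-- By `mixedSum_geometric`, 1 - tq times the reciprocal of the master sum is 1/(ztq;q)_m -
tq/(z;q)_m, which dictates the choice of F. -/
theorem hasSum_words_geometric {I : Ideal R} (hI : PowersTendToZero I) (q p t r : R) {z : R}
    (hz : z ∈ I) (m : ℕ) {D : R}
    (hD : D * ((qPoch z q m - t * q * qPoch (z * t * q) q m) * qPoch (z * r) q (m + 1)) = 1) :
    HasSum (fun w : Σ n, Fin n → Fin (m + 1) => wordTerm q p t r z m w.1 w.2)
      (p ^ m * ((1 - q * t) * qPoch z q m * qPoch (z * t * q) q m * D)) := by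
  have hmem : ∀ i, z * q ^ i ∈ I := fun i => I.mul_mem_right _ hz
  choose G₁ h₁ using fun i => exists_mul_one_sub_eq_one hI (hmem i)
  choose G₀ h₀ using fun i => exists_mul_one_sub_eq_one hI (I.mul_mem_left r (hmem i))
  choose G₂ h₂ using fun i => exists_mul_one_sub_eq_one hI (I.mul_mem_left t (hmem i))
  have hP := prod_qPoch_eq_one h₁ m
  have hQ : (∏ i ∈ Finset.range m, G₂ (i + 1)) * qPoch (z * t * q) q m = 1 :=
    prod_qPoch_eq_one (fun i => by linear_combination h₂ (i + 1)) m
  have hR : (∏ i ∈ Finset.range (m + 1), G₀ i) * qPoch (z * r) q (m + 1) = 1 :=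
    prod_qPoch_eq_one (fun i => by linear_combination h₀ i) (m + 1)
  have h := hasSum_words hI t r (y := fun a : Fin (m + 1) => z * q ^ (m - (a : ℕ)))
    (g₁ := fun a => G₁ (m - a)) (g₀ := fun a => G₀ (m - a)) (g₂ := fun a => G₂ (m - a))
    (fun a => hmem _) (fun a => h₁ _) (fun a => h₀ _) (fun a => h₂ _)
    (F := (1 - q * t) * qPoch z q m * qPoch (z * t * q) q m * (D * qPoch (z * r) q (m + 1))) (by
      rw [prod_fin_reflect]
      have hM := mixedSum_geometric h₁ h₂ m
      generalize mixedSum (R := R) (N := m + 1) _ _ = M at *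
      linear_combination (-qPoch z q m * qPoch (z * t * q) q m * (D * qPoch (z * r) q (m + 1))) * hM
        + hD + D * qPoch (z * r) q (m + 1) * qPoch z q m * hQ
        - t * q * D * qPoch (z * r) q (m + 1) * qPoch (z * t * q) q m * hP)
  refine hasSum_of_eq (h.mul_left (p ^ m)) (fun w => rfl) ?_
  rw [prod_fin_reflect]
  linear_combination (-p ^ m * (1 - q * t) * qPoch z q m * qPoch (z * t * q) q m * D) * hR

/-- Exchange of the size of the alphabet and the length of a word. -/
def sigmaSwap : (Σ n, Σ m, Fin n → Fin (m + 1)) ≃ (Σ m, Σ n, Fin n → Fin (m + 1)) where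
  toFun x := ⟨x.2.1, x.1, x.2.2⟩
  invFun x := ⟨x.2.1, x.1, x.2.2⟩
  left_inv _ := rfl
  right_inv _ := rfl

/-- The quadruple distribution, in a complete ring where `p` and `z` are small. -/
theorem exists_hasSum_enumerator {I : Ideal R} (hI : PowersTendToZero I) (q : R) {p : R} (t r : R)
    {z : R} (hp : p ∈ I) (hz : z ∈ I) {L D : ℕ → R} (hL : ∀ n, L n * qPoch p q (n + 1) = 1)
    (hD : ∀ m, D m * ((qPoch z q m - t * q * qPoch (z * t * q) q m)
      * qPoch (z * r) q (m + 1)) = 1) :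
    ∃ S, HasSum (fun n => PermStat.enumerator n q p t r * (z ^ n * L n)) S ∧
      HasSum (fun m => p ^ m * ((1 - q * t) * qPoch z q m * qPoch (z * t * q) q m * D m)) S := by
  have hs : Summable (fun x : Σ m, Σ n, Fin n → Fin (m + 1) =>
      wordTerm q p t r z x.1 x.2.1 x.2.2) :=
    summable_of_mem_pow hI _ finite_words fun x => wordTerm_mem_pow q t r hp hz _ _ _
  choose h hh using fun j => exists_mul_one_sub_eq_one hI (I.mul_mem_right (q ^ j) hp)
  refine ⟨_, ?_, hs.hasSum.sigma fun m => hasSum_words_geometric hI q p t r hz m (hD m)⟩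
  refine (sigmaSwap.hasSum_iff.2 hs.hasSum).sigma fun n => ?_
  refine hasSum_of_eq (hasSum_wordTerm hI q p t r z hp n hh) (fun _ => rfl) ?_
  have h1 := prod_qPoch_eq_one hh (n + 1)
  have h2 : L n = ∏ j : Fin (n + 1), h j := by
    rw [← Finset.prod_range]
    linear_combination (∏ i ∈ Finset.range (n + 1), h i) * hL n - L n * h1
  rw [h2]

end Sums

end MajDes

/-! ### The coefficientwise topology on power series. -/

namespace AdicSum

section MvPowerSeries

variable {σ k : Type*} [Field k]

theorem le_order_of_mem_pow {f : MvPowerSeries σ k} {n : ℕ}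
    (hf : f ∈ (RingHom.ker (MvPowerSeries.constantCoeff (σ := σ) (R := k))) ^ n) :
    (n : ℕ∞) ≤ f.order := by
  induction n generalizing f with
  | zero => simp
  | succ n ih =>
    rw [pow_succ'] at hf
    refine Submodule.mul_induction_on hf (fun a ha b hb => ?_) fun a b ha hb => ?_
    · have h1 : 1 ≤ a.order := MvPowerSeries.one_le_order_iff_constCoeff_eq_zero.2 ha
      refine le_trans ?_ MvPowerSeries.le_order_mul
      rw [add_comm a.order]
      push_cast
      exact add_le_add (ih hb) h1
    · exact (le_min ha hb).trans MvPowerSeries.min_order_le_add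

variable [TopologicalSpace k]

theorem exists_finset_pi_subset {ι : Type*} {U : Set (ι → k)} (hU : U ∈ 𝓝 (0 : ι → k)) :
    ∃ s : Finset ι, ∀ f : ι → k, (∀ d ∈ s, f d = 0) → f ∈ U := by
  rw [nhds_pi, Filter.mem_pi'] at hU
  obtain ⟨s, V, hV, hsub⟩ := hU
  refine ⟨s, fun f hf => hsub fun d hd => ?_⟩
  rw [hf d hd]
  exact mem_of_mem_nhds (hV d)

theorem exists_finset_coeff_subset {U : Set (MvPowerSeries σ k)} (hU : U ∈ 𝓝 0) :
    ∃ s : Finset (σ →₀ ℕ), ∀ f : MvPowerSeries σ k,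
      (∀ d ∈ s, MvPowerSeries.coeff d f = 0) → f ∈ U :=
  exists_finset_pi_subset (U := U) hU

variable [DiscreteTopology k]

theorem nonarchimedeanRing_mvPowerSeries : NonarchimedeanRing (MvPowerSeries σ k) where
  is_nonarchimedean U hU := by
    obtain ⟨s, hs⟩ := exists_finset_coeff_subset hU
    refine ⟨⟨⨅ d ∈ s, (MvPowerSeries.coeff d).toAddMonoidHom.ker, ?_⟩, fun f hf => hs f ?_⟩
    · have : ((⨅ d ∈ s, (MvPowerSeries.coeff (R := k) d).toAddMonoidHom.ker :
          AddSubgroup (MvPowerSeries σ k)) : Set (MvPowerSeries σ k))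
          = ⋂ d ∈ s, (MvPowerSeries.coeff (R := k) d) ⁻¹' {0} := by
        ext f
        simp [AddMonoidHom.mem_ker]
      change IsOpen ((⨅ d ∈ s, (MvPowerSeries.coeff (R := k) d).toAddMonoidHom.ker :
          AddSubgroup (MvPowerSeries σ k)) : Set (MvPowerSeries σ k))
      rw [this]
      exact isOpen_biInter_finset fun d _ => (isOpen_discrete _).preimage
        (MvPowerSeries.WithPiTopology.continuous_coeff k d)
    · intro d hd
      have h1 : f ∈ (⨅ d ∈ s, (MvPowerSeries.coeff (R := k) d).toAddMonoidHom.ker :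
          AddSubgroup (MvPowerSeries σ k)) := hf
      simp only [AddSubgroup.mem_iInf] at h1
      exact h1 d hd

end MvPowerSeries

/-- A neighbourhood of 0 constrains finitely many coefficients, and elements of the n-th power have
order at least n. -/
theorem powersTendToZero_ker_constantCoeff {σ k : Type*} [Field k] [UniformSpace k]
    [DiscreteUniformity k] :
    PowersTendToZero (RingHom.ker (MvPowerSeries.constantCoeff (σ := σ) (R := k))) := by
  intro U hU
  obtain ⟨s, hs⟩ := exists_finset_coeff_subset hU
  refine ⟨s.sup Finsupp.degree + 1, fun f hf => hs f fun d hd => ?_⟩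
  refine MvPowerSeries.coeff_of_lt_order (lt_of_lt_of_le ?_ (le_order_of_mem_pow hf))
  exact_mod_cast Nat.lt_succ_of_le (Finset.le_sup (f := Finsupp.degree) hd)

end AdicSum

open FiveVar in
theorem corollary1p4 :
    ∃ S : FiveVar.Series,
      FormalHasSum
        (fun n : ℕ => PermStat.enumerator n q p t r * (z ^ n * (qPoch p q (n + 1))⁻¹)) S ∧
      FormalHasSum
        (fun m : ℕ => p ^ m * ((1 - q * t) * qPoch z q m * qPoch (z * t * q) q m *
          ((qPoch z q m - t * q * qPoch (z * t * q) q m) * qPoch (z * r) q (m + 1))⁻¹)) S := by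
  -- The discrete uniformity, whose topology is the one in `FormalHasSum`.
  let _ : UniformSpace ℚ := ⊥
  have : NonarchimedeanRing FiveVar.Series := AdicSum.nonarchimedeanRing_mvPowerSeries
  exact MajDes.exists_hasSum_enumerator AdicSum.powersTendToZero_ker_constantCoeff q t r
    (MvPowerSeries.constantCoeff_X _) (MvPowerSeries.constantCoeff_X _)
    (fun n => MvPowerSeries.inv_mul_cancel _ (by
      rw [constantCoeff_lhs_denominator]; exact one_ne_zero))
    (fun m => MvPowerSeries.inv_mul_cancel _ (by
      rw [constantCoeff_rhs_denominator]; exact one_ne_zero))
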